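/- **Setting.** Let $V=\mathbb C^N$ ($N\ge 1$) and let $U_1,\dots,U_t$ be commuting unitary operators on $V$ with a real (fixed by complex conjugation) orthonormal joint eigenbasis $\psi_1,\dots,\psi_N$, with vectors of eigenvalues $v_k\in\mathbb C^t$ ($U_j\psi_k=(v_k)_j\psi_k$) that are $\epsilon$-separated: $\|v_k-v_l\|_2\ge\epsilon>0$ for $k\ne l$. Phase estimation is treated as ideal: a measurement that leaves the $\psi_k$ unchanged and outputs, on $\psi_k$, a classical string $v$ (a serial number) denoting a vector with $\|v-v_k\|_2<\epsilon/3$. A digital signature scheme (key generation, signing, verification) signs serial numbers. A bill consists of a note in $V\otimes V$, a serial number $v$ and a signature $\sigma$. *Verification* checks that $\sigma$ is a signature of $v$ and then tests, by a projective measurement of each half of the note, that it lies in the span of the $\psi_k$ with $\|v-v_k\|_2<\epsilon/2$; bills are called valid if they pass. *Minting* prepares a maximally entangled state of $V\otimes V$, applies phase estimation to the first half to obtain $v$, and signs $v$. A *uniformly random bill* consists of the note $\psi_k\otimes\psi_k$ with $k$ uniform in $\{1,\dots,N\}$, a phase estimate $v$ of $v_k$, and a signature of $v$. Quantum algorithms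 are adaptive: each step is an elementary operation on registers holding vectors of $V$ and on qubits (a gate from a fixed arbitrary gate set, a controlled $U_j$, a measurement, preparation of a maximally entangled state, phase estimation, the test of a register against a serial number, key generation, signing, signature verification, or a call to a signing oracle if there is one) and it may depend on the classical input and on all earlier outcomes. Each operation has a fixed cost; an oracle call costs as much as signing. Time is the total cost in the worst case; the classical choice of the next operation is not charged. Let $c$, $w$, $g$ be the times to run once the minting algorithm, the verification algorithm and key generation. *Solving Problem 3.1* means to output a state $|\psi\rangle|\psi\rangle|\psi\rangle$ where $\psi$ is an eigenvector of all the $U_j$; for an algorithm with output $\rho$ on three registers, its probability is $\sum_k\langle\psi_k\psi_k\psi_k|\rho|\psi_k\psi_k\psi_k\rangle$. A *new valid signature* is a pair $(m,\sigma)$ that verifies, where $m$ was not submitted to the signing oracle. **Theorem.** There are absolute constants $C,\kappa>0$ such that the following hold. The algorithms whose existence is asserted are constructed from the given adversary (and $p$, in (i) and (iii)) alone: they work for all $U_1,\dots,U_t$, $\epsilon$ and all signature schemes (of the given sizes and formats) for which the adversary has the stated success probability. 1. (Attacks by the mint.) If an adversary who is given the verification key and the signing key can in time $T$, with probability at least $p\in(0,1]$,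 produce $n+1$ valid bills with at most $n$ distinct serial numbers among them, then there is an algorithm that, given the same keys, runs in time $C(T+w)/p$ and solves Problem 3.1 with probability at least $\kappa$. 2. (Attacks by others.) If an adversary, given the verification key, $n$ independent uniformly random bills and the signed serial numbers of $s$ further ones, but not the signing key, can in time $T$, with probability at least $p$, produce $n+1$ bills that pass verification, then there is an algorithm that, given the verification key and at most $n+s$ calls to an oracle for the signing algorithm, runs in time $CT+c(n+s)$ and with probability at least $p$ either outputs a new valid signature or solves Problem 3.1. 3. (Attacks on random instances.) Suppose an adversary as in 2 runs in time $T$ and succeeds with probability at least $p\in(0,1]$, where the probability is now also over the random key pair of the signature scheme. Then either - there is an algorithm that, given a random verification key and at most $n+s$ calls to an oracle for the signing algorithm, runs in time $CT+c(n+s)$ and outputs a new valid signature with probability at least $p/2$, or - there is an algorithm, without any input or oracle for keys, that runs in time $C\,(T+c(n+s)+w+g)/p$ and solves Problem 3.1 with probability at least $1/2$. -/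

import Mathlib

open scoped BigOperators

noncomputable section

namespace QMoney

/-! ### Quantum memory

The memory consists of registers holding vectors of `V = ℂ^N` (indexed by `R`) and of qubits
(indexed by `Q`).  States are (not necessarily normalized) vectors given by their coordinates in
the computational basis. -/

/-- Computational basis states of a memory with `V`-registers `R` and qubits `Q`. -/
abbrev Config (N : ℕ) (R Q : Type) : Type := (R → Fin N) × (Q → Bool)

/-- Pure (possibly subnormalized) states of the memory. -/
abbrev QState (N : ℕ) (R Q : Type) : Type := Config N R Q → ℂ

/-- The squared norm of a state: the probability of the branch of the computation that it
describes. -/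
def normSq {N : ℕ} {R Q : Type} [Fintype R] [DecidableEq R] [Fintype Q] [DecidableEq Q]
    (φ : QState N R Q) : ℝ :=
  ∑ x, ‖φ x‖ ^ 2

/-- The operator with matrix `A` on the registers `e i` and the qubits `q l` (pairwise distinct),
tensored with the identity on the rest of the memory. -/
def applyLocal {N : ℕ} {R Q K L : Type} [Fintype K] [DecidableEq K] [Fintype L] [DecidableEq L]
    (e : K → R) (q : L → Q) (A : Matrix (Config N K L) (Config N K L) ℂ)
    (φ : QState N R Q) : QState N R Q :=
  fun x => ∑ y : Config N K L,
    A (x.1 ∘ e, x.2 ∘ q) y * φ (Function.extend e y.1 x.1, Function.extend q y.2 x.2)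

/-- The operator with matrix `A` on the single register `r`. -/
def onReg {N : ℕ} {R Q : Type} (r : R) (A : Matrix (Fin N) (Fin N) ℂ)
    (φ : QState N R Q) : QState N R Q :=
  applyLocal (fun _ : Unit => r) (Empty.elim : Empty → Q)
    (Matrix.of fun x y => A (x.1 ()) (y.1 ())) φ

/-- Projection of the register `r` onto the computational basis state `a`. -/
def projReg {N : ℕ} {R Q : Type} (r : R) (a : Fin N) (φ : QState N R Q) : QState N R Q :=
  fun x => if x.1 r = a then φ x else 0

/-- Projection of the qubit `q` onto the computational basis state `b`. -/
def projQubit {N : ℕ} {R Q : Type} (q : Q) (b : Bool) (φ : QState N R Q) : QState N R Q :=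
  fun x => if x.2 q = b then φ x else 0

/-- The state on the branch where the classical bit `c` is announced as `b`. -/
def branchOn {N : ℕ} {R Q : Type} (c b : Bool) (φ : QState N R Q) : QState N R Q :=
  if c = b then φ else 0

/-! ### The computing model

An arbitrary gate set, arbitrary finite formats for the classical data, and arbitrary running
times of the elementary operations. -/

/-- The sizes, the formats of classical data, the gate set and the prices of operations. -/
structure Model where
  /-- dimension of `V` -/
  N : ℕ
  N_ne : NeZero N
  /-- number of commuting operators -/
  t : ℕ
  /-- serial numbers (classical data); they are also the messages that get signed -/
  Ser : Type
  /-- verification keys -/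
  VK : Type
  /-- signing keys -/
  SK : Type
  /-- signatures -/
  Sig : Type
  serFin : Fintype Ser
  serDec : DecidableEq Ser
  vkFin : Fintype VK
  skFin : Fintype SK
  sigFin : Fintype Sig
  sigDec : DecidableEq Sig
  /-- elementary quantum gates -/
  Gate : Type
  gateRegs : Gate → ℕ
  gateQubits : Gate → ℕ
  gateMat : (g : Gate) → Matrix.unitaryGroup (Config N (Fin (gateRegs g)) (Fin (gateQubits g))) ℂ
  costGate : Gate → ℕ
  /-- time of one call to a controlled `U_j` -/
  costU : ℕ
  /-- time of a measurement in the computational basis -/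
  costMeas : ℕ
  /-- time to prepare a maximally entangled state of two registers -/
  costBell : ℕ
  /-- time of phase estimation of a register with respect to all the `U_j` -/
  costEst : ℕ
  /-- time to test one register against a serial number by phase estimation with all the `U_j` -/
  costTest : ℕ
  /-- time to generate a pair of keys -/
  costGen : ℕ
  /-- time to sign (also charged for a call to a signing oracle) -/
  costSign : ℕ
  /-- time to verify a signature -/
  costVer : ℕ

attribute [instance] Model.N_ne Model.serFin Model.serDec Model.vkFin Model.skFin Model.sigFin
  Model.sigDec

/-- Elementary operations on a memory with registers `R` and qubits `Q`; `Ask` is the type of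
queries to an external signing oracle (`Empty` when there is no such oracle). -/
inductive Op (M : Model) (Ask R Q : Type) : Type
  | gate (g : M.Gate) (e : Fin (M.gateRegs g) ↪ R) (q : Fin (M.gateQubits g) ↪ Q)
  | ctrlU (j : Fin M.t) (q : Q) (r : R)
  | measReg (r : R)
  | measQubit (q : Q)
  | bell (r r' : R) (h : r ≠ r')
  | phaseEst (r : R)
  | eigTest (v : M.Ser) (r : R)
  | keyGen
  | sign (sk : M.SK) (m : M.Ser)
  | verSig (vk : M.VK) (m : M.Ser) (σ : M.Sig)
  | ask (a : Ask)

/-- The type of classical outcomes of an operation. -/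
def Op.Out {M : Model} {Ask R Q : Type} : Op M Ask R Q → Type
  | .gate _ _ _ => Unit
  | .ctrlU _ _ _ => Unit
  | .measReg _ => Fin M.N
  | .measQubit _ => Bool
  | .bell _ _ _ => Fin M.N × Fin M.N
  | .phaseEst _ => M.Ser
  | .eigTest _ _ => Bool
  | .keyGen => M.VK × M.SK
  | .sign _ _ => M.Sig
  | .verSig _ _ _ => Bool
  | .ask _ => M.Sig

instance Op.outFintype {M : Model} {Ask R Q : Type} : (o : Op M Ask R Q) → Fintype o.Out
  | .gate _ _ _ => inferInstanceAs (Fintype Unit)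
  | .ctrlU _ _ _ => inferInstanceAs (Fintype Unit)
  | .measReg _ => inferInstanceAs (Fintype (Fin M.N))
  | .measQubit _ => inferInstanceAs (Fintype Bool)
  | .bell _ _ _ => inferInstanceAs (Fintype (Fin M.N × Fin M.N))
  | .phaseEst _ => inferInstanceAs (Fintype M.Ser)
  | .eigTest _ _ => inferInstanceAs (Fintype Bool)
  | .keyGen => inferInstanceAs (Fintype (M.VK × M.SK))
  | .sign _ _ => inferInstanceAs (Fintype M.Sig)
  | .verSig _ _ _ => inferInstanceAs (Fintype Bool)
  | .ask _ => inferInstanceAs (Fintype M.Sig)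

/-- Time of an elementary operation. -/
def Op.cost {M : Model} {Ask R Q : Type} : Op M Ask R Q → ℕ
  | .gate g _ _ => M.costGate g
  | .ctrlU _ _ _ => M.costU
  | .measReg _ => M.costMeas
  | .measQubit _ => M.costMeas
  | .bell _ _ _ => M.costBell
  | .phaseEst _ => M.costEst
  | .eigTest _ _ => M.costTest
  | .keyGen => M.costGen
  | .sign _ _ => M.costSign
  | .verSig _ _ _ => M.costVer
  | .ask _ => M.costSign

/-- The oracle queries made by an operation (at most one). -/
def Op.queries {M : Model} {Ask R Q : Type} : Op M Ask R Q → List Ask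
  | .ask a => [a]
  | _ => []

/-- Adaptive quantum programs: a program either stops with a classical result or performs an
elementary operation and continues according to its classical outcome. -/
inductive Prog (M : Model) (Ask R Q α : Type) : Type
  | ret (a : α) : Prog M Ask R Q α
  | step (o : Op M Ask R Q) (k : o.Out → Prog M Ask R Q α) : Prog M Ask R Q α

namespace Prog

variable {M : Model} {Ask R Q α β : Type}

/-- Sequential composition. -/
def bind : Prog M Ask R Q α → (α → Prog M Ask R Q β) → Prog M Ask R Q β
  | ret a, f => f a
  | step o k, f => step o fun a => (k a).bind f

/-- Worst-case running time. -/
def cost : Prog M Ask R Q α → ℕ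
  | ret _ => 0
  | step o k => o.cost + Finset.univ.sup fun a => (k a).cost

/-- Worst-case number of oracle queries. -/
def asks : Prog M Ask R Q α → ℕ
  | ret _ => 0
  | step o k => o.queries.length + Finset.univ.sup fun a => (k a).asks

end Prog

/-! ### The operators and the signature scheme -/

/-- The operators `U_1, …, U_t` on `V = ℂ^N`, commuting, unitary, with a real `ε`-separated
eigenbasis, and the (ideal) phase estimation for them.  The estimate is a serial number `v`, whose
`val` is a vector of complex numbers; on the joint eigenvector `k` the estimate `v` has amplitude
`amp v k`, and with certainty it has `L²`-error less than `ε / 3`. -/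
structure Instance (M : Model) where
  U : Fin M.t → Matrix.unitaryGroup (Fin M.N) ℂ
  comm : ∀ i j, Commute (U i) (U j)
  basis : OrthonormalBasis (Fin M.N) ℂ (EuclideanSpace ℂ (Fin M.N))
  real : ∀ k x, star (basis k x) = basis k x
  /-- the vectors of eigenvalues -/
  eig : Fin M.N → EuclideanSpace ℂ (Fin M.t)
  isEig : ∀ j k, ((U j : Matrix (Fin M.N) (Fin M.N) ℂ).mulVec fun x => basis k x)
    = fun x => eig k j * basis k x
  ε : ℝ
  ε_pos : 0 < ε
  separated : ∀ k l, k ≠ l → ε ≤ ‖eig k - eig l‖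
  val : M.Ser → EuclideanSpace ℂ (Fin M.t)
  amp : M.Ser → Fin M.N → ℂ
  amp_sum : ∀ k, ∑ v, ‖amp v k‖ ^ 2 = 1
  amp_near : ∀ v k, amp v k ≠ 0 → ‖val v - eig k‖ < ε / 3

/-- A digital signature scheme. -/
structure SigScheme (M : Model) where
  gen : PMF (M.VK × M.SK)
  sign : M.SK → M.Ser → PMF M.Sig
  verify : M.VK → M.Ser → M.Sig → Bool
  correct : ∀ vk sk m σ, (vk, sk) ∈ gen.support → σ ∈ (sign sk m).support →
    verify vk m σ = true

namespace Instance

variable {M : Model} (I : Instance M)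

/-- The orthogonal projection onto the `k`-th joint eigenvector. -/
def proj (k : Fin M.N) : Matrix (Fin M.N) (Fin M.N) ℂ :=
  Matrix.of fun x y => I.basis k x * star (I.basis k y)

open Classical in
/-- The orthogonal projection onto the span of the joint eigenvectors whose vectors of eigenvalues
are within `ε / 2` of the serial number `v`. -/
def nearProj (v : M.Ser) : Matrix (Fin M.N) (Fin M.N) ℂ :=
  ∑ k ∈ Finset.univ.filter (fun k => ‖I.val v - I.eig k‖ < I.ε / 2), I.proj k

/-- Measurement operators of phase estimation with outcome `v`. -/
def estOp (v : M.Ser) : Matrix (Fin M.N) (Fin M.N) ℂ :=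
  ∑ k, I.amp v k • I.proj k

/-- The matrix of the controlled `U_j` on a register and a qubit. -/
def ctrlMat (j : Fin M.t) : Matrix (Config M.N Unit Unit) (Config M.N Unit Unit) ℂ :=
  Matrix.of fun x y =>
    if x.2 = y.2 then
      (if x.2 () then (I.U j : Matrix (Fin M.N) (Fin M.N) ℂ) (x.1 ()) (y.1 ())
        else if x.1 = y.1 then 1 else 0)
    else 0

end Instance

/-- The operator `|Φ⟩⟨a b|`, with `Φ = N^{-1/2} ∑ x, |x x⟩` maximally entangled. -/
def bellMat (N : ℕ) (a : Fin N × Fin N) :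
    Matrix (Config N (Fin 2) Empty) (Config N (Fin 2) Empty) ℂ :=
  Matrix.of fun x y =>
    if x.1 0 = x.1 1 ∧ y.1 0 = a.1 ∧ y.1 1 = a.2 then ((1 / Real.sqrt N : ℝ) : ℂ) else 0

/-- The effect on the state of the operation `o` when its outcome is `a` (the measurement operator
of that outcome).  Classical randomized operations multiply the state by the square root of the
probability of the outcome.  `bell` discards the contents of its registers (measuring them in the
computational basis) before it prepares the entangled state. -/
def Op.apply {M : Model} {Ask R Q : Type} (I : Instance M) (D : SigScheme M)
    (orc : Ask → PMF M.Sig) :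
    (o : Op M Ask R Q) → o.Out → QState M.N R Q → QState M.N R Q
  | .gate g e q, _, φ => applyLocal e q (M.gateMat g : Matrix _ _ ℂ) φ
  | .ctrlU j q r, _, φ => applyLocal (fun _ : Unit => r) (fun _ : Unit => q) (I.ctrlMat j) φ
  | .measReg r, a, φ => projReg r a φ
  | .measQubit q, a, φ => projQubit q a φ
  | .bell r r' _, a, φ => applyLocal ![r, r'] (Empty.elim : Empty → Q) (bellMat M.N a) φ
  | .phaseEst r, v, φ => onReg r (I.estOp v) φ
  | .eigTest v r, true, φ => onReg r (I.nearProj v) φ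
  | .eigTest v r, false, φ => onReg r (1 - I.nearProj v) φ
  | .keyGen, a, φ => ((Real.sqrt (D.gen a).toReal : ℝ) : ℂ) • φ
  | .sign sk m, a, φ => ((Real.sqrt (D.sign sk m a).toReal : ℝ) : ℂ) • φ
  | .verSig vk m σ, b, φ => branchOn (D.verify vk m σ) b φ
  | .ask q, a, φ => ((Real.sqrt (orc q a).toReal : ℝ) : ℂ) • φ

/-- Run a program from the state `φ`, the queries `l` having been made before, and add up the
values of `F` over all branches.  With `F l a φ = normSq φ` when `(l, a)` satisfies a condition
and `0` otherwise, this is the probability that the final log and result satisfy the condition. -/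
def Prog.expect {M : Model} {Ask R Q α : Type} (I : Instance M) (D : SigScheme M)
    (orc : Ask → PMF M.Sig) (F : List Ask → α → QState M.N R Q → ℝ) :
    Prog M Ask R Q α → List Ask → QState M.N R Q → ℝ
  | .ret a, l, φ => F l a φ
  | .step o k, l, φ =>
      ∑ a : o.Out, (k a).expect I D orc F (l ++ o.queries) (o.apply I D orc a φ)

/-! ### Bills, verification and minting -/

/-- A list of `m` alleged bills: the note of the `i`-th one is held in the registers `left i` and
`right i`. -/
structure Bills (M : Model) (m : ℕ) (R : Type) where
  left : Fin m → R
  right : Fin m → R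
  distinct : Function.Injective (Sum.elim left right)
  serial : Fin m → M.Ser
  sig : Fin m → M.Sig

/-- The verification algorithm: check the signature, then test both halves of the note. -/
def verify {M : Model} {Ask R Q : Type} (vk : M.VK) (r r' : R) (v : M.Ser) (σ : M.Sig) :
    Prog M Ask R Q Bool :=
  .step (.verSig vk v σ) fun (b : Bool) =>
    .step (.eigTest v r) fun (b₁ : Bool) =>
      .step (.eigTest v r') fun (b₂ : Bool) => .ret (b && b₁ && b₂)

/-- Verify the bills with the indices in a list one after the other; do all of them pass? -/
def verifyList {M : Model} {Ask R Q : Type} {m : ℕ} (vk : M.VK) (x : Bills M m R) :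
    List (Fin m) → Prog M Ask R Q Bool
  | [] => .ret true
  | i :: is => (verify vk (x.left i) (x.right i) (x.serial i) (x.sig i)).bind fun b =>
      (verifyList vk x is).bind fun b' => .ret (b && b')

/-- Do all `m` bills pass the verification algorithm? -/
def verifyAll {M : Model} {Ask R Q : Type} {m : ℕ} (vk : M.VK) (x : Bills M m R) :
    Prog M Ask R Q Bool :=
  verifyList vk x (List.finRange m)

/-- The minting algorithm, with the note placed into the registers `r`, `r'`. -/
def mint {M : Model} {Ask R Q : Type} (sk : M.SK) (r r' : R) (h : r ≠ r') :
    Prog M Ask R Q (M.Ser × M.Sig) :=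
  .step (.bell r r' h) fun _ =>
    .step (.phaseEst r) fun (v : M.Ser) =>
      .step (.sign sk v) fun (σ : M.Sig) => .ret (v, σ)

/-- Time to run the verification algorithm once. -/
def Model.verifyTime (M : Model) : ℕ := M.costVer + (M.costTest + M.costTest)

/-- Time to run the minting algorithm once. -/
def Model.mintTime (M : Model) : ℕ := M.costBell + (M.costEst + M.costSign)

theorem sup_const_univ {β : Type} [Fintype β] [Nonempty β] (c : ℕ) :
    (Finset.univ : Finset β).sup (fun _ => c) = c :=
  Finset.sup_const Finset.univ_nonempty c

theorem verify_cost {M : Model} {Ask R Q : Type} (vk : M.VK) (r r' : R) (v : M.Ser) (σ : M.Sig) :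
    (verify vk r r' v σ : Prog M Ask R Q Bool).cost = M.verifyTime := by
  change M.costVer + (Finset.univ : Finset Bool).sup (fun _ =>
    M.costTest + (Finset.univ : Finset Bool).sup (fun _ =>
      M.costTest + (Finset.univ : Finset Bool).sup (fun _ => 0))) = _
  simp only [sup_const_univ, add_zero, Model.verifyTime]

theorem mint_cost {M : Model} {Ask R Q : Type} [Nonempty M.Ser] [Nonempty M.Sig] (sk : M.SK)
    (r r' : R) (h : r ≠ r') :
    (mint sk r r' h : Prog M Ask R Q (M.Ser × M.Sig)).cost = M.mintTime := by
  change M.costBell + (Finset.univ : Finset (Fin M.N × Fin M.N)).sup (fun _ =>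
    M.costEst + (Finset.univ : Finset M.Ser).sup (fun _ =>
      M.costSign + (Finset.univ : Finset M.Sig).sup (fun _ => 0))) = _
  simp only [sup_const_univ, add_zero, Model.mintTime]

/-! ### Algorithms and attacks -/

/-- A quantum algorithm with classical input in `In` and `n` notes as quantum input, whose classical
result in `Out R` may point to registers of its memory. -/
structure Alg (M : Model) (Ask In : Type) (n : ℕ) (Out : Type → Type) where
  R : Type
  Q : Type
  finR : Fintype R
  decR : DecidableEq R
  finQ : Fintype Q
  decQ : DecidableEq Q
  /-- the registers of the input notes -/
  inReg : Fin n × Fin 2 ↪ R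
  prog : In → Prog M Ask R Q (Out R)

attribute [instance] Alg.finR Alg.decR Alg.finQ Alg.decQ

/-- The algorithm runs in time at most `T`. -/
def Alg.RunsIn {M : Model} {Ask In : Type} {n : ℕ} {Out : Type → Type}
    (A : Alg M Ask In n Out) (T : ℝ) : Prop :=
  ∀ x, ((A.prog x).cost : ℝ) ≤ T

/-- The algorithm makes at most `q` calls to its oracle. -/
def Alg.AsksAtMost {M : Model} {Ask In : Type} {n : ℕ} {Out : Type → Type}
    (A : Alg M Ask In n Out) (q : ℕ) : Prop :=
  ∀ x, (A.prog x).asks ≤ q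

open Classical in
/-- The initial memory: the `i`-th input note is `ψ_{k i} ⊗ ψ_{k i}`, everything else is zero. -/
def Alg.init {M : Model} {Ask In : Type} {n : ℕ} {Out : Type → Type}
    (A : Alg M Ask In n Out) (I : Instance M) (k : Fin n → Fin M.N) : QState M.N A.R A.Q :=
  fun x => if (∀ r, r ∉ Set.range A.inReg → x.1 r = 0) ∧ (∀ q, x.2 q = false) then
    ∏ i, ∏ h, I.basis (k i) (x.1 (A.inReg (i, h))) else 0

/-- The probability weight of a result `true`. -/
def acceptWeight {M : Model} {Ask R Q : Type} [Fintype R] [DecidableEq R] [Fintype Q]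
    [DecidableEq Q] (_ : List Ask) (b : Bool) (φ : QState M.N R Q) : ℝ :=
  if b then normSq φ else 0

/-- `∑ k, |⟨ψ_k ψ_k ψ_k| φ⟩|²` for the three registers `e`: the probability weight with which they
contain a state `|ψ⟩|ψ⟩|ψ⟩` with `|ψ⟩` a joint eigenvector.  (By the separation, the `ψ_k` are the
only joint eigenvectors up to scalars.) -/
def tripleWeight {M : Model} {R Q : Type} [Fintype R] [DecidableEq R] [Fintype Q]
    [DecidableEq Q] (I : Instance M) (e : Fin 3 ↪ R) (φ : QState M.N R Q) : ℝ :=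
  normSq (applyLocal e (Empty.elim : Empty → Q)
    (Matrix.of fun x y => ∑ k, ∏ i, I.proj k (x.1 i) (y.1 i)) φ)

/-- The probability weight with which `c = (m, σ)` is a new valid signature: it verifies, and `m`
was not submitted to the signing oracle. -/
def newSigWeight {M : Model} {R Q : Type} [Fintype R] [DecidableEq R] [Fintype Q]
    [DecidableEq Q] (D : SigScheme M) (vk : M.VK) (l : List M.Ser) (c : M.Ser × M.Sig)
    (φ : QState M.N R Q) : ℝ :=
  if D.verify vk c.1 c.2 = true ∧ c.1 ∉ l then normSq φ else 0

/-- An attacker who knows both keys and outputs `n + 1` bills. -/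
abbrev MintAttack (M : Model) (n : ℕ) : Type 1 := Alg M Empty (M.VK × M.SK) 0 (Bills M (n + 1))

/-- The probability that a mint attack outputs `n + 1` bills with at most `n` serial numbers among
them, all of which pass verification. -/
def MintAttack.prob {M : Model} {n : ℕ} (A : MintAttack M n) (I : Instance M) (D : SigScheme M)
    (vk : M.VK) (sk : M.SK) : ℝ :=
  ((A.prog (vk, sk)).bind fun x => (verifyAll vk x).bind fun b =>
      .ret (b && decide ((Finset.univ.image x.serial).card ≤ n))).expect I D
    (fun a => a.elim) acceptWeight [] (A.init I Fin.elim0)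

/-- An attacker who knows the verification key, `n` bills (with their serial numbers and
signatures) and `s` further signed serial numbers, and outputs `n + 1` bills. -/
abbrev Attack (M : Model) (n s : ℕ) : Type 1 :=
  Alg M Empty (M.VK × (Fin n → M.Ser × M.Sig) × (Fin s → M.Ser × M.Sig)) n (Bills M (n + 1))

/-- The distribution of a uniformly random bill: a uniform note `ψ_k ⊗ ψ_k`, the estimate `v` of
its eigenvalues, and the signature of `v`. -/
def billProb {M : Model} (I : Instance M) (D : SigScheme M) (sk : M.SK)
    (b : Fin M.N × M.Ser × M.Sig) : ℝ :=
  (1 / (M.N : ℝ)) * ‖I.amp b.2.1 b.1‖ ^ 2 * (D.sign sk b.2.1 b.2.2).toReal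

/-- The probability that all `n + 1` output bills pass verification, when the attacker receives `n`
independent uniformly random bills and the signed serial numbers of `s` further ones. -/
def Attack.prob {M : Model} {n s : ℕ} (A : Attack M n s) (I : Instance M) (D : SigScheme M)
    (vk : M.VK) (sk : M.SK) : ℝ :=
  ∑ x : Fin n → Fin M.N × M.Ser × M.Sig, ∑ y : Fin s → Fin M.N × M.Ser × M.Sig,
    (∏ i, billProb I D sk (x i)) * (∏ i, billProb I D sk (y i)) *
      ((A.prog (vk, fun i => (x i).2, fun i => (y i).2)).bind fun z => verifyAll vk z).expect I D
        (fun a => a.elim) acceptWeight [] (A.init I fun i => (x i).1)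

/-- An algorithm, with classical input in `In`, that should output a triple eigenstate. -/
abbrev Solver (M : Model) (In : Type) : Type 1 := Alg M Empty In 0 (fun R => Fin 3 ↪ R)

/-- The probability that the solver outputs a triple eigenstate. -/
def Solver.prob {M : Model} {In : Type} (B : Solver M In) (I : Instance M) (D : SigScheme M)
    (x : In) : ℝ :=
  (B.prog x).expect I D (fun a => a.elim) (fun _ e φ => tripleWeight I e φ) []
    (B.init I Fin.elim0)

/-- An algorithm with the verification key and a signing oracle that should output a new
signature. -/
abbrev Forger (M : Model) : Type 1 := Alg M M.Ser M.VK 0 (fun _ => M.Ser × M.Sig)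

/-- The probability that the forger outputs a new valid signature. -/
def Forger.prob {M : Model} (B : Forger M) (I : Instance M) (D : SigScheme M)
    (vk : M.VK) (sk : M.SK) : ℝ :=
  (B.prog vk).expect I D (D.sign sk) (fun l c φ => newSigWeight D vk l c φ) []
    (B.init I Fin.elim0)

/-- An algorithm with the verification key and a signing oracle that should output either a new
signature or a triple eigenstate. -/
abbrev ForgerOrSolver (M : Model) : Type 1 :=
  Alg M M.Ser M.VK 0 (fun R => (M.Ser × M.Sig) ⊕ (Fin 3 ↪ R))

/-- The probability that the output is a new valid signature or a triple eigenstate. -/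
def ForgerOrSolver.prob {M : Model} (B : ForgerOrSolver M) (I : Instance M) (D : SigScheme M)
    (vk : M.VK) (sk : M.SK) : ℝ :=
  (B.prog vk).expect I D (D.sign sk)
    (fun l c φ => Sum.elim (fun c => newSigWeight D vk l c φ) (fun e => tripleWeight I e φ) c) []
    (B.init I Fin.elim0)

/-- The average of `f` over a random pair of keys. -/
def SigScheme.keyAverage {M : Model} (D : SigScheme M) (f : M.VK → M.SK → ℝ) : ℝ :=
  ∑ a : M.VK × M.SK, (D.gen a).toReal * f a.1 a.2

end QMoney

end

/-! By `ε`-separation, at most one joint eigenvector lies within `ε / 2` of a serial number `v`, so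
the test against `v` is either zero or the rank-one projection onto a single `ψ_k`
(`nearProj_cases`). Two valid bills with the same serial number therefore contain at least three
copies of the same eigenvector, which is a solution of Problem 3.1.

For the mint this is the pigeonhole principle: `n + 1` bills with at most `n` serial numbers repeat
one. Both halves of one such note and one half of the other pass three tests against the common
serial number with at least the attack's acceptance probability (`passWeight_le_tripleTest`),
because these tests are among the commuting projections that verification applies anyway. The test
announces its success, so about `1 / p` attempts in fresh memory give constant success probability
(`le_prob_iterate`, `half_le_one_sub_pow`).

The other attackers are simulated. Since the eigenbasis is real, the maximally entangled state is
`N^{-1/2} ∑ ψ_k ⊗ ψ_k`. Phase estimation of one half selects a single `k`, so minting produces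
exactly a uniformly random bill (`expect_mintWith`). The simulator mints `n + s` bills, hands over
`n` of them with the signed serial numbers of all, and keeps `s` notes. Among the returned `n + 1`
bills, either some serial number is new, giving a forgery; or two coincide; or one equals that of a
kept note, half of which completes a triple (`passWeight_le_extract`). Hence the acceptance
probability is at most the forgery weight plus the triple weight (`prob_le_simulate`).

On random keys one of the two averaged weights is at least `p / 2`. If it is the triple weight, a
solver generates its own keys, replaces oracle calls by signing, and repeats the search. All
reductions use only the adversary and classical outcomes, so they do not depend on the operators or
on the signature scheme. -/

noncomputable section

namespace QMoney

/-! ### Moving programs to a larger memory -/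

section Programs

variable {M : Model} {Ask Ask' R R' Q Q' α β : Type}

/-- The operation `o`, performed on the registers and qubits that correspond to those of `o` under
the embeddings `e` and `q` of memories. -/
def Op.relabel (h : Ask → Ask') (e : R ↪ R') (q : Q ↪ Q') : Op M Ask R Q → Op M Ask' R' Q'
  | .gate g e' q' => .gate g (e'.trans e) (q'.trans q)
  | .ctrlU j b r => .ctrlU j (q b) (e r)
  | .measReg r => .measReg (e r)
  | .measQubit b => .measQubit (q b)
  | .bell r r' hr => .bell (e r) (e r') (e.injective.ne hr)
  | .phaseEst r => .phaseEst (e r)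
  | .eigTest v r => .eigTest v (e r)
  | .keyGen => .keyGen
  | .sign sk m => .sign sk m
  | .verSig vk m σ => .verSig vk m σ
  | .ask a => .ask (h a)

/-- Relabelling does not change the outcomes of an operation. -/
def Op.relabelOut (h : Ask → Ask') (e : R ↪ R') (q : Q ↪ Q') :
    (o : Op M Ask R Q) → (o.relabel h e q).Out ≃ o.Out
  | .gate _ _ _ => Equiv.refl Unit
  | .ctrlU _ _ _ => Equiv.refl Unit
  | .measReg _ => Equiv.refl (Fin M.N)
  | .measQubit _ => Equiv.refl Bool
  | .bell _ _ _ => Equiv.refl (Fin M.N × Fin M.N)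
  | .phaseEst _ => Equiv.refl M.Ser
  | .eigTest _ _ => Equiv.refl Bool
  | .keyGen => Equiv.refl (M.VK × M.SK)
  | .sign _ _ => Equiv.refl M.Sig
  | .verSig _ _ _ => Equiv.refl Bool
  | .ask _ => Equiv.refl M.Sig

theorem Op.cost_relabel (h : Ask → Ask') (e : R ↪ R') (q : Q ↪ Q') (o : Op M Ask R Q) :
    (o.relabel h e q).cost = o.cost := by
  cases o <;> rfl

theorem Op.queries_relabel (h : Ask → Ask') (e : R ↪ R') (q : Q ↪ Q') (o : Op M Ask R Q) :
    (o.relabel h e q).queries = o.queries.map h := by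
  cases o <;> rfl

/-- A program, executed in a part of a larger memory. -/
def Prog.relabel (h : Ask → Ask') (e : R ↪ R') (q : Q ↪ Q') :
    Prog M Ask R Q α → Prog M Ask' R' Q' α
  | .ret a => .ret a
  | .step o k => .step (o.relabel h e q) fun a => (k (o.relabelOut h e q a)).relabel h e q

theorem Prog.cost_relabel_le (h : Ask → Ask') (e : R ↪ R') (q : Q ↪ Q') (P : Prog M Ask R Q α) :
    (P.relabel h e q).cost ≤ P.cost := by
  induction P with
  | ret a => exact le_rfl
  | step o k ih =>
    refine Nat.add_le_add (Op.cost_relabel h e q o).le (Finset.sup_le fun a _ => ?_)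
    exact (ih _).trans (Finset.le_sup (f := fun a => (k a).cost) (Finset.mem_univ _))

theorem Prog.asks_relabel_le (h : Ask → Ask') (e : R ↪ R') (q : Q ↪ Q') (P : Prog M Ask R Q α) :
    (P.relabel h e q).asks ≤ P.asks := by
  induction P with
  | ret a => exact le_rfl
  | step o k ih =>
    refine Nat.add_le_add ?_ (Finset.sup_le fun a _ => ?_)
    · rw [Op.queries_relabel, List.length_map]
    · exact (ih _).trans (Finset.le_sup (f := fun a => (k a).asks) (Finset.mem_univ _))

theorem Prog.asks_eq_zero [IsEmpty Ask] (P : Prog M Ask R Q α) : P.asks = 0 := by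
  induction P with
  | ret a => rfl
  | step o k ih =>
    have h0 : o.queries = [] := List.eq_nil_of_subset_nil fun a => isEmptyElim a
    have h1 : (Finset.univ.sup fun a => (k a).asks) = 0 :=
      Nat.le_zero.mp (Finset.sup_le fun a _ => (ih a).le)
    change o.queries.length + (Finset.univ.sup fun a => (k a).asks) = 0
    rw [h0, h1]; rfl

theorem Prog.cost_bind_le (P : Prog M Ask R Q α) (f : α → Prog M Ask R Q β) (c : ℕ)
    (hf : ∀ a, (f a).cost ≤ c) : (P.bind f).cost ≤ P.cost + c := by
  induction P with
  | ret a => exact (hf a).trans (Nat.le_add_left _ _)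
  | step o k ih =>
    change o.cost + (Finset.univ.sup fun a => ((k a).bind f).cost) ≤
      o.cost + (Finset.univ.sup fun a => (k a).cost) + c
    rw [add_assoc]
    refine Nat.add_le_add_left (Finset.sup_le fun a ha => (ih a).trans ?_) _
    exact Nat.add_le_add_right (Finset.le_sup (f := fun a => (k a).cost) ha) _

theorem Prog.asks_bind_le (P : Prog M Ask R Q α) (f : α → Prog M Ask R Q β) (c : ℕ)
    (hf : ∀ a, (f a).asks ≤ c) : (P.bind f).asks ≤ P.asks + c := by
  induction P with
  | ret a => exact (hf a).trans (Nat.le_add_left _ _)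
  | step o k ih =>
    change o.queries.length + (Finset.univ.sup fun a => ((k a).bind f).asks) ≤
      o.queries.length + (Finset.univ.sup fun a => (k a).asks) + c
    rw [add_assoc]
    refine Nat.add_le_add_left (Finset.sup_le fun a ha => (ih a).trans ?_) _
    exact Nat.add_le_add_right (Finset.le_sup (f := fun a => (k a).asks) ha) _

theorem Prog.cost_step_le (o : Op M Ask R Q) (k : o.Out → Prog M Ask R Q α) (c : ℕ)
    (hk : ∀ a, (k a).cost ≤ c) : (Prog.step o k).cost ≤ o.cost + c :=
  Nat.add_le_add_left (Finset.sup_le fun a _ => hk a) _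

theorem Prog.asks_step_le (o : Op M Ask R Q) (k : o.Out → Prog M Ask R Q α) (c : ℕ)
    (hk : ∀ a, (k a).asks ≤ c) : (Prog.step o k).asks ≤ o.queries.length + c :=
  Nat.add_le_add_left (Finset.sup_le fun a _ => hk a) _

/-! ### Expectations -/

variable (I : Instance M) (D : SigScheme M) (orc : Ask → PMF M.Sig)

/-- Whatever follows a program acts on each of its branches separately. Verification appended to an
attack thus becomes a weight on the attack's final states. -/
theorem Prog.expect_bind (F : List Ask → β → QState M.N R Q → ℝ) (P : Prog M Ask R Q α)
    (f : α → Prog M Ask R Q β) (l : List Ask) (φ : QState M.N R Q) :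
    (P.bind f).expect I D orc F l φ =
      P.expect I D orc (fun l a φ => (f a).expect I D orc F l φ) l φ := by
  induction P generalizing l φ with
  | ret a => rfl
  | step o k ih => exact Finset.sum_congr rfl fun a _ => ih a _ _

/-- Reduces comparisons of success probabilities to inequalities on single branches. -/
theorem Prog.expect_mono {F G : List Ask → α → QState M.N R Q → ℝ}
    (h : ∀ l a φ, F l a φ ≤ G l a φ) (P : Prog M Ask R Q α) (l : List Ask)
    (φ : QState M.N R Q) : P.expect I D orc F l φ ≤ P.expect I D orc G l φ := by
  induction P generalizing l φ with
  | ret a => exact h _ _ _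
  | step o k ih => exact Finset.sum_le_sum fun a _ => ih a _ _

theorem Prog.expect_add (F G : List Ask → α → QState M.N R Q → ℝ) (P : Prog M Ask R Q α)
    (l : List Ask) (φ : QState M.N R Q) :
    P.expect I D orc (fun l a φ => F l a φ + G l a φ) l φ =
      P.expect I D orc F l φ + P.expect I D orc G l φ := by
  induction P generalizing l φ with
  | ret a => rfl
  | step o k ih =>
    simp only [Prog.expect, ih, Finset.sum_add_distrib]

theorem Prog.expect_const_mul (c : ℝ) (F : List Ask → α → QState M.N R Q → ℝ)
    (P : Prog M Ask R Q α) (l : List Ask) (φ : QState M.N R Q) :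
    P.expect I D orc (fun l a φ => c * F l a φ) l φ = c * P.expect I D orc F l φ := by
  induction P generalizing l φ with
  | ret a => rfl
  | step o k ih =>
    simp only [Prog.expect, ih, Finset.mul_sum]

theorem Prog.expect_zero (P : Prog M Ask R Q α) (l : List Ask) (φ : QState M.N R Q) :
    P.expect I D orc (fun _ _ _ => 0) l φ = 0 := by
  induction P generalizing l φ with
  | ret a => rfl
  | step o k ih => simp only [Prog.expect, ih, Finset.sum_const_zero]

end Programs

/-! ### Local operators -/

section Local

variable {N : ℕ} {R R' Q Q' K L : Type} [Fintype K] [DecidableEq K] [Fintype L] [DecidableEq L]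

theorem extend_comp_self {A B C : Type} {e : A → B} (he : e.Injective) (x : B → C) :
    Function.extend e (x ∘ e) x = x := by
  funext b
  by_cases hb : ∃ a, e a = b
  · obtain ⟨a, rfl⟩ := hb
    rw [he.extend_apply]; rfl
  · rw [Function.extend_apply' _ _ _ hb]

theorem extend_extend {A B C : Type} {e : A → B} (he : e.Injective) (y z : A → C) (x : B → C) :
    Function.extend e z (Function.extend e y x) = Function.extend e z x := by
  funext b
  by_cases hb : ∃ a, e a = b
  · obtain ⟨a, rfl⟩ := hb
    rw [he.extend_apply, he.extend_apply]
  · simp only [Function.extend_apply' _ _ _ hb]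

theorem extend_comp {A B C : Type} {e : A → B} (he : e.Injective) (y : A → C) (x : B → C) :
    Function.extend e y x ∘ e = y :=
  funext fun a => he.extend_apply _ _ a

theorem applyLocal_smul (e : K → R) (q : L → Q) (A : Matrix (Config N K L) (Config N K L) ℂ)
    (c : ℂ) (φ : QState N R Q) : applyLocal e q A (c • φ) = c • applyLocal e q A φ := by
  funext x
  simp only [applyLocal, Pi.smul_apply, smul_eq_mul, Finset.mul_sum]
  exact Finset.sum_congr rfl fun y _ => by ring

theorem applyLocal_sum {ι : Type} (s : Finset ι) (e : K → R) (q : L → Q)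
    (A : Matrix (Config N K L) (Config N K L) ℂ) (φ : ι → QState N R Q) :
    applyLocal e q A (∑ i ∈ s, φ i) = ∑ i ∈ s, applyLocal e q A (φ i) := by
  funext x
  simp only [applyLocal, Finset.sum_apply, Finset.mul_sum]
  exact Finset.sum_comm

theorem applyLocal_sum_matrix {ι : Type} (s : Finset ι) (e : K → R) (q : L → Q)
    (A : ι → Matrix (Config N K L) (Config N K L) ℂ) (φ : QState N R Q) :
    applyLocal e q (∑ i ∈ s, A i) φ = ∑ i ∈ s, applyLocal e q (A i) φ := by
  funext x
  simp only [applyLocal, Finset.sum_apply, Matrix.sum_apply, Finset.sum_mul]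
  exact Finset.sum_comm

theorem applyLocal_one {e : K → R} {q : L → Q} (he : e.Injective) (hq : q.Injective)
    (φ : QState N R Q) : applyLocal e q (1 : Matrix (Config N K L) (Config N K L) ℂ) φ = φ := by
  funext x
  simp only [applyLocal, Matrix.one_apply, ite_mul, one_mul, zero_mul, Finset.sum_ite_eq,
    Finset.mem_univ, if_true, extend_comp_self he, extend_comp_self hq]

theorem applyLocal_mul {e : K → R} {q : L → Q} (he : e.Injective) (hq : q.Injective)
    (A B : Matrix (Config N K L) (Config N K L) ℂ) (φ : QState N R Q) :
    applyLocal e q A (applyLocal e q B φ) = applyLocal e q (A * B) φ := by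
  funext x
  simp only [applyLocal, extend_comp he, extend_comp hq, extend_extend he, extend_extend hq,
    Matrix.mul_apply, Finset.sum_mul, Finset.mul_sum, mul_assoc]
  exact Finset.sum_comm

variable [Fintype R] [DecidableEq R] [Fintype Q] [DecidableEq Q]

/-- Exchange a part of a configuration with a separate copy of this part. -/
def exchange {e : K → R} {q : L → Q} (he : e.Injective) (hq : q.Injective) :
    Config N R Q × Config N K L ≃ Config N R Q × Config N K L :=
  Function.Involutive.toPerm
    (fun p => ((Function.extend e p.2.1 p.1.1, Function.extend q p.2.2 p.1.2),
      (p.1.1 ∘ e, p.1.2 ∘ q)))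
    (fun p => by
      simp only [extend_extend he, extend_extend hq, extend_comp_self he, extend_comp_self hq,
        extend_comp he, extend_comp hq])

omit [Fintype K] [DecidableEq K] [Fintype L] [DecidableEq L] [Fintype R] [DecidableEq R] [Fintype Q]
  [DecidableEq Q] in
theorem exchange_apply {e : K → R} {q : L → Q} (he : e.Injective) (hq : q.Injective)
    (p : Config N R Q × Config N K L) :
    exchange he hq p = ((Function.extend e p.2.1 p.1.1, Function.extend q p.2.2 p.1.2),
      (p.1.1 ∘ e, p.1.2 ∘ q)) := rfl

/-- In the double sum over a configuration and a new local part, swapping the old and the new local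
part is an involution. It moves the matrix to the other side as its adjoint. -/
theorem dotProduct_applyLocal {e : K → R} {q : L → Q} (he : e.Injective) (hq : q.Injective)
    (A : Matrix (Config N K L) (Config N K L) ℂ) (φ χ : QState N R Q) :
    star φ ⬝ᵥ applyLocal e q A χ = star (applyLocal e q A.conjTranspose φ) ⬝ᵥ χ := by
  simp only [dotProduct, applyLocal, Pi.star_apply, star_sum, star_mul', Finset.mul_sum,
    Finset.sum_mul, Matrix.conjTranspose_apply, star_star]
  rw [← Fintype.sum_prod_type', ← Fintype.sum_prod_type']
  refine Fintype.sum_equiv (exchange he hq) _ _ fun p => ?_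
  simp only [exchange_apply, extend_extend he, extend_extend hq, extend_comp_self he,
    extend_comp_self hq, extend_comp he, extend_comp hq]
  ring

theorem normSq_eq_dotProduct (φ : QState N R Q) : ((normSq φ : ℝ) : ℂ) = star φ ⬝ᵥ φ := by
  simp only [normSq, dotProduct, Pi.star_apply, Complex.ofReal_sum]
  refine Finset.sum_congr rfl fun x _ => ?_
  rw [RCLike.star_def, Complex.conj_mul']
  push_cast; rfl

theorem normSq_nonneg (φ : QState N R Q) : 0 ≤ normSq φ :=
  Finset.sum_nonneg fun _ _ => sq_nonneg _

theorem normSq_smul (c : ℂ) (φ : QState N R Q) : normSq (c • φ) = ‖c‖ ^ 2 * normSq φ := by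
  simp only [normSq, Pi.smul_apply, smul_eq_mul, norm_mul, mul_pow, Finset.mul_sum]

theorem normSq_zero : normSq (0 : QState N R Q) = 0 := by simp [normSq]

/-- The squared norms are `⟨φ, (A i)* (A i) φ⟩`, so the completeness relation of a measurement is
conservation of probability. -/
theorem sum_normSq_applyLocal {ι : Type} [Fintype ι] {e : K → R} {q : L → Q} (he : e.Injective)
    (hq : q.Injective) (A : ι → Matrix (Config N K L) (Config N K L) ℂ)
    (hA : ∑ i, (A i).conjTranspose * A i = 1) (φ : QState N R Q) :
    ∑ i, normSq (applyLocal e q (A i) φ) = normSq φ := by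
  apply Complex.ofReal_injective
  rw [Complex.ofReal_sum, normSq_eq_dotProduct]
  simp only [normSq_eq_dotProduct]
  have : ∀ i, star (applyLocal e q (A i) φ) ⬝ᵥ applyLocal e q (A i) φ =
      star φ ⬝ᵥ applyLocal e q ((A i).conjTranspose * A i) φ := fun i => by
    rw [← applyLocal_mul he hq, dotProduct_applyLocal he hq _ φ, Matrix.conjTranspose_conjTranspose]
  simp only [this]
  rw [← dotProduct_sum, ← applyLocal_sum_matrix, hA, applyLocal_one he hq]

/-- A projection `A` and its complement `1 - A` form a two-outcome measurement, and one branch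
weighs at most as much as both together. -/
theorem normSq_applyLocal_le {e : K → R} {q : L → Q} (he : e.Injective)
    (hq : q.Injective) {A : Matrix (Config N K L) (Config N K L) ℂ}
    (hs : A.conjTranspose = A) (hA : A * A = A) (φ : QState N R Q) :
    normSq (applyLocal e q A φ) ≤ normSq φ := by
  have h := sum_normSq_applyLocal he hq (fun b : Bool => if b then A else 1 - A) (by
    simp only [Fintype.sum_bool, if_true, Bool.false_eq_true, if_false, Matrix.conjTranspose_sub,
      Matrix.conjTranspose_one, hs, sub_mul, mul_sub, hA, one_mul, mul_one]
    abel) φ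
  rw [Fintype.sum_bool] at h
  have h2 := normSq_nonneg (applyLocal e q (if false = true then A else 1 - A) φ)
  simp only [if_true] at h
  linarith

end Local

/-! ### Operations on a single register -/

section OnReg

variable {N : ℕ} {R Q : Type}

theorem injective_const_unit {A : Type} (r : A) : Function.Injective (fun _ : Unit => r) :=
  Function.injective_of_subsingleton _

theorem injective_emptyElim {A : Type} : Function.Injective (Empty.elim : Empty → A) :=
  Function.injective_of_subsingleton _

/-- The matrix of `A` as an operator on a memory with one register and no qubits. -/
abbrev regMat (A : Matrix (Fin N) (Fin N) ℂ) :
    Matrix (Config N Unit Empty) (Config N Unit Empty) ℂ :=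
  Matrix.of fun x y => A (x.1 ()) (y.1 ())

/-- Configurations of a single register. -/
def configUnit : Config N Unit Empty ≃ Fin N :=
  (Equiv.prodUnique _ _).trans (Equiv.funUnique Unit (Fin N))

theorem regMat_mul (A B : Matrix (Fin N) (Fin N) ℂ) : regMat A * regMat B = regMat (A * B) := by
  ext x y
  simp only [Matrix.mul_apply, Matrix.of_apply]
  exact Fintype.sum_equiv configUnit _ _ fun z => rfl

theorem regMat_one : regMat (1 : Matrix (Fin N) (Fin N) ℂ) = 1 := by
  ext x y
  simp only [Matrix.of_apply, Matrix.one_apply]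
  exact if_congr (configUnit.injective.eq_iff (a := x) (b := y)) rfl rfl

theorem regMat_conjTranspose (A : Matrix (Fin N) (Fin N) ℂ) :
    (regMat A).conjTranspose = regMat A.conjTranspose := rfl

theorem regMat_sum {ι : Type} (s : Finset ι) (A : ι → Matrix (Fin N) (Fin N) ℂ) :
    ∑ i ∈ s, regMat (A i) = regMat (∑ i ∈ s, A i) := by
  ext x y
  simp only [Matrix.sum_apply, Matrix.of_apply]

theorem onReg_onReg (r : R) (A B : Matrix (Fin N) (Fin N) ℂ) (φ : QState N R Q) :
    onReg r A (onReg r B φ) = onReg r (A * B) φ := by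
  simp only [onReg]
  rw [applyLocal_mul (injective_const_unit r) injective_emptyElim, regMat_mul]

theorem onReg_smul (r : R) (A : Matrix (Fin N) (Fin N) ℂ) (c : ℂ) (φ : QState N R Q) :
    onReg r A (c • φ) = c • onReg r A φ :=
  applyLocal_smul _ _ _ _ _

theorem onReg_zero (r : R) (A : Matrix (Fin N) (Fin N) ℂ) :
    onReg r A (0 : QState N R Q) = 0 := by
  funext x
  simp [onReg, applyLocal]

theorem extend_const_unit [DecidableEq R] {C : Type} (r : R) (y : Unit → C) (x : R → C) :
    Function.extend (fun _ : Unit => r) y x = Function.update x r (y ()) := by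
  funext r'
  by_cases h : r' = r
  · subst h
    rw [Function.update_self]
    exact (injective_const_unit r').extend_apply y x ()
  · rw [Function.update_of_ne h, Function.extend_apply' _ _ _ fun ⟨_, h'⟩ => h h'.symm]

theorem extend_emptyElim {A C : Type} (y : Empty → C) (x : A → C) :
    Function.extend (Empty.elim : Empty → A) y x = x :=
  funext fun _ => Function.extend_apply' _ _ _ fun ⟨a, _⟩ => a.elim

theorem onReg_apply [DecidableEq R] (r : R) (A : Matrix (Fin N) (Fin N) ℂ) (φ : QState N R Q)
    (x : Config N R Q) :
    onReg r A φ x = ∑ a, A (x.1 r) a * φ (Function.update x.1 r a, x.2) := by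
  simp only [onReg, applyLocal, extend_const_unit, extend_emptyElim]
  exact Fintype.sum_equiv configUnit _ _ fun z => rfl

/-- The two operators change different coordinates. This allows the tests of bills to be reordered.
-/
theorem onReg_comm [DecidableEq R] {r r' : R} (h : r ≠ r') (A B : Matrix (Fin N) (Fin N) ℂ)
    (φ : QState N R Q) : onReg r A (onReg r' B φ) = onReg r' B (onReg r A φ) := by
  funext x
  simp only [onReg_apply, Function.update_of_ne h, Function.update_of_ne h.symm, Finset.mul_sum]
  rw [Finset.sum_comm]
  refine Finset.sum_congr rfl fun a _ => Finset.sum_congr rfl fun b _ => ?_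
  rw [Function.update_comm h]
  ring

theorem sum_normSq_onReg [Fintype R] [DecidableEq R] [Fintype Q] [DecidableEq Q] {ι : Type}
    [Fintype ι] (r : R) (A : ι → Matrix (Fin N) (Fin N) ℂ)
    (hA : ∑ i, (A i).conjTranspose * A i = 1) (φ : QState N R Q) :
    ∑ i, normSq (onReg r (A i) φ) = normSq φ := by
  refine sum_normSq_applyLocal (injective_const_unit r) injective_emptyElim
    (fun i => regMat (A i)) ?_ φ
  simp only [regMat_conjTranspose, regMat_mul, regMat_sum, hA, regMat_one]

theorem normSq_onReg_le [Fintype R] [DecidableEq R] [Fintype Q] [DecidableEq Q] (r : R)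
    {A : Matrix (Fin N) (Fin N) ℂ} (hs : A.conjTranspose = A) (hA : A * A = A)
    (φ : QState N R Q) : normSq (onReg r A φ) ≤ normSq φ :=
  normSq_applyLocal_le (injective_const_unit r) injective_emptyElim
    (by rw [regMat_conjTranspose, hs]) (by rw [regMat_mul, hA]) φ

end OnReg

/-! ### The projections onto the joint eigenvectors -/

namespace Instance

variable {M : Model} (I : Instance M)

theorem conj_basis (k x : Fin M.N) : (starRingEnd ℂ) (I.basis k x) = I.basis k x := I.real k x

theorem sum_basis_mul_basis (k l : Fin M.N) :
    ∑ x, I.basis k x * I.basis l x = if k = l then 1 else 0 := by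
  have h := orthonormal_iff_ite.mp I.basis.orthonormal k l
  rw [← h, PiLp.inner_apply]
  refine Finset.sum_congr rfl fun x _ => ?_
  rw [RCLike.inner_apply, I.conj_basis, mul_comm]

/-- A one-sided inverse of a square matrix is two-sided, so the orthonormal real rows also have
orthonormal columns. The absence of conjugates is what makes `∑ ψ_k ⊗ ψ_k` equal to `∑ x, |x x⟩`. -/
theorem sum_basis_apply_mul (x y : Fin M.N) :
    ∑ k, I.basis k x * I.basis k y = if x = y then 1 else 0 := by
  have h : (Matrix.of fun k x => I.basis k x) * (Matrix.of fun k x => I.basis k x).transpose = 1 := by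
    ext k l
    simp only [Matrix.mul_apply, Matrix.transpose_apply, Matrix.of_apply, Matrix.one_apply]
    exact I.sum_basis_mul_basis k l
  have h' := congrArg (fun A => A x y) (mul_eq_one_comm.mp h)
  simpa only [Matrix.mul_apply, Matrix.transpose_apply, Matrix.of_apply, Matrix.one_apply] using h'

theorem proj_apply (k x y : Fin M.N) : I.proj k x y = I.basis k x * I.basis k y := by
  simp only [proj, Matrix.of_apply, I.real]

theorem proj_mul_proj (k l : Fin M.N) :
    I.proj k * I.proj l = if k = l then I.proj k else 0 := by
  ext x y
  have : ∀ z, I.proj k x z * I.proj l z y =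
      I.basis k x * I.basis l y * (I.basis k z * I.basis l z) := fun z => by
    rw [I.proj_apply, I.proj_apply]; ring
  simp only [Matrix.mul_apply, this, ← Finset.mul_sum, I.sum_basis_mul_basis]
  split_ifs with h
  · subst h
    rw [I.proj_apply, mul_one]
  · rw [mul_zero]; rfl

theorem proj_conjTranspose (k : Fin M.N) : (I.proj k).conjTranspose = I.proj k := by
  ext x y
  rw [Matrix.conjTranspose_apply, I.proj_apply, I.proj_apply, star_mul', I.real, I.real, mul_comm]

theorem sum_proj : ∑ k, I.proj k = 1 := by
  ext x y
  simp only [Matrix.sum_apply, I.proj_apply, I.sum_basis_apply_mul, Matrix.one_apply]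

theorem proj_mulVec_basis (k l : Fin M.N) :
    (I.proj k).mulVec (fun x => I.basis l x) = if k = l then (fun x => I.basis l x) else 0 := by
  funext x
  simp only [Matrix.mulVec, dotProduct, I.proj_apply, mul_assoc, ← Finset.mul_sum,
    I.sum_basis_mul_basis]
  split_ifs with h
  · rw [h, mul_one]
  · simp

/-- At most one vector of eigenvalues is within `ε / 2` of a given vector. -/
theorem near_unique {w : EuclideanSpace ℂ (Fin M.t)} {k l : Fin M.N}
    (hk : ‖w - I.eig k‖ < I.ε / 2) (hl : ‖w - I.eig l‖ < I.ε / 2) : k = l := by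
  by_contra h
  have h1 := I.separated k l h
  have h2 : ‖I.eig k - I.eig l‖ ≤ ‖w - I.eig k‖ + ‖w - I.eig l‖ := by
    rw [norm_sub_rev w (I.eig k)]
    calc ‖I.eig k - I.eig l‖ = ‖(I.eig k - w) + (w - I.eig l)‖ := by congr 1; abel
      _ ≤ _ := norm_add_le _ _
  linarith

theorem near_of_amp_ne_zero {v : M.Ser} {k : Fin M.N} (h : I.amp v k ≠ 0) :
    ‖I.val v - I.eig k‖ < I.ε / 2 := by
  have := I.amp_near v k h
  have := I.ε_pos
  linarith

theorem nearProj_eq_proj {v : M.Ser} {k : Fin M.N} (h : ‖I.val v - I.eig k‖ < I.ε / 2) :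
    I.nearProj v = I.proj k := by
  classical
  have : Finset.univ.filter (fun l => ‖I.val v - I.eig l‖ < I.ε / 2) = {k} := by
    ext l
    simp only [Finset.mem_filter, Finset.mem_univ, true_and, Finset.mem_singleton]
    exact ⟨fun hl => I.near_unique hl h, fun hl => hl ▸ h⟩
  rw [nearProj]
  convert Finset.sum_singleton _ k

theorem nearProj_eq_zero {v : M.Ser} (h : ∀ k, ¬ ‖I.val v - I.eig k‖ < I.ε / 2) :
    I.nearProj v = 0 := by
  rw [nearProj]
  exact Finset.sum_eq_zero fun k hk => absurd (Finset.mem_filter.mp hk).2 (h k)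

/-- The central consequence of separation: passing a test pins down one eigenvector, not merely an
eigenspace of higher dimension. -/
theorem nearProj_cases (v : M.Ser) : I.nearProj v = 0 ∨ ∃ k, I.nearProj v = I.proj k := by
  by_cases h : ∃ k, ‖I.val v - I.eig k‖ < I.ε / 2
  · exact Or.inr ⟨_, I.nearProj_eq_proj h.choose_spec⟩
  · exact Or.inl (I.nearProj_eq_zero (not_exists.mp h))

theorem nearProj_mul_self (v : M.Ser) : I.nearProj v * I.nearProj v = I.nearProj v := by
  rcases I.nearProj_cases v with h | ⟨k, h⟩ <;> rw [h]
  · rw [mul_zero]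
  · rw [proj_mul_proj, if_pos rfl]

theorem nearProj_conjTranspose (v : M.Ser) : (I.nearProj v).conjTranspose = I.nearProj v := by
  rcases I.nearProj_cases v with h | ⟨k, h⟩ <;> rw [h]
  · rw [Matrix.conjTranspose_zero]
  · rw [proj_conjTranspose]

/-- Orthogonality of the projections removes the cross terms, and for each `k` the probabilities of
the estimates add up to one. -/
theorem sum_estOp :
    ∑ v, (I.estOp v).conjTranspose * I.estOp v = 1 := by
  have h : ∀ v, (I.estOp v).conjTranspose * I.estOp v =
      ∑ k, ((‖I.amp v k‖ ^ 2 : ℝ) : ℂ) • I.proj k := fun v => by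
    simp only [estOp, Matrix.conjTranspose_sum, Matrix.conjTranspose_smul, proj_conjTranspose,
      Finset.sum_mul, Finset.mul_sum, Matrix.smul_mul, Matrix.mul_smul, proj_mul_proj, smul_ite,
      smul_zero, Finset.sum_ite_eq', Finset.mem_univ, if_true, smul_smul]
    refine Finset.sum_congr rfl fun k _ => ?_
    rw [RCLike.star_def, Complex.mul_conj']
    push_cast; rfl
  simp only [h]
  rw [Finset.sum_comm]
  simp only [← Finset.sum_smul, ← Complex.ofReal_sum, I.amp_sum, Complex.ofReal_one, one_smul,
    I.sum_proj]

theorem ctrlMat_unitary (j : Fin M.t) : (I.ctrlMat j).conjTranspose * I.ctrlMat j = 1 := by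
  have hU : ∀ a b, ∑ c, star ((I.U j : Matrix (Fin M.N) (Fin M.N) ℂ) c a) *
      (I.U j : Matrix (Fin M.N) (Fin M.N) ℂ) c b = if a = b then 1 else 0 := fun a b => by
    have h := congrArg (fun A => A a b) (Matrix.mem_unitaryGroup_iff'.mp (I.U j).2)
    simpa only [Matrix.mul_apply, Matrix.star_apply, Matrix.one_apply] using h
  -- In these coordinates the matrix is block diagonal, with blocks `1` and `U j` indexed by the
  -- control bit.
  let E : Config M.N Unit Unit ≃ Fin M.N × Bool :=
    (Equiv.funUnique Unit (Fin M.N)).prodCongr (Equiv.funUnique Unit Bool)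
  have hE : ∀ x y, I.ctrlMat j (E.symm x) (E.symm y) = if x.2 = y.2 then
      (if x.2 then (I.U j : Matrix (Fin M.N) (Fin M.N) ℂ) x.1 y.1 else if x.1 = y.1 then 1 else 0)
      else 0 := fun x y =>
    if_congr (Equiv.funUnique Unit Bool).symm.injective.eq_iff
      (if_congr Iff.rfl rfl
        (if_congr (Equiv.funUnique Unit (Fin M.N)).symm.injective.eq_iff rfl rfl)) rfl
  ext x y
  obtain ⟨⟨a, b⟩, rfl⟩ := E.symm.surjective x
  obtain ⟨⟨a', b'⟩, rfl⟩ := E.symm.surjective y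
  rw [Matrix.mul_apply, ← E.symm.sum_comp, Matrix.one_apply, Fintype.sum_prod_type]
  simp only [Matrix.conjTranspose_apply, hE, Fintype.sum_bool, Prod.mk.injEq,
    E.symm.injective.eq_iff]
  cases b <;> cases b' <;> simp [eq_comm]
  simpa [eq_comm] using hU a a'

end Instance

/-- Since `⟨Φ, Φ⟩ = 1`, the operator `|Φ⟩⟨a b|` composed with its adjoint is `|a b⟩⟨a b|`, and these
projections sum to the identity. -/
theorem sum_bellMat (N : ℕ) [NeZero N] :
    ∑ a, (bellMat N a).conjTranspose * bellMat N a = 1 := by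
  let E : Config N (Fin 2) Empty ≃ Fin N × Fin N :=
    (Equiv.prodUnique _ _).trans (finTwoArrowEquiv (Fin N))
  have hE : ∀ a x y, bellMat N a (E.symm x) (E.symm y) =
      if x.1 = x.2 ∧ y = a then ((1 / Real.sqrt N : ℝ) : ℂ) else 0 := fun a x y =>
    if_congr (and_congr Iff.rfl Prod.ext_iff.symm) rfl rfl
  -- This is the normalization of `Φ`: it has `N` nonzero coordinates, each of square `1 / N`.
  have hN : (N : ℂ) * (((1 / Real.sqrt N : ℝ) : ℂ) * ((1 / Real.sqrt N : ℝ) : ℂ)) = 1 := by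
    have h0 : (N : ℝ) ≠ 0 := Nat.cast_ne_zero.mpr (NeZero.ne N)
    rw [← Complex.ofReal_mul, ← Complex.ofReal_natCast, ← Complex.ofReal_mul,
      div_mul_div_comm, Real.mul_self_sqrt (Nat.cast_nonneg N), one_mul, mul_one_div_cancel h0,
      Complex.ofReal_one]
  ext x y
  obtain ⟨x, rfl⟩ := E.symm.surjective x
  obtain ⟨y, rfl⟩ := E.symm.surjective y
  simp only [Matrix.sum_apply, Matrix.mul_apply, Matrix.one_apply, E.symm.injective.eq_iff]
  have h1 : ∀ a, ∑ z, (bellMat N a).conjTranspose (E.symm x) z * bellMat N a z (E.symm y) =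
      if x = a then (if y = a then 1 else 0) else 0 := fun a => by
    rw [← E.symm.sum_comp]
    simp only [Matrix.conjTranspose_apply, hE]
    by_cases hx : x = a <;> by_cases hy : y = a <;>
      simp [hx, hy, Fintype.sum_prod_type, Complex.conj_ofReal, ← hN]
  simp only [h1, Finset.sum_ite_eq, Finset.mem_univ, if_true]
  exact if_congr eq_comm rfl rfl

/-! ### Conservation of probability and homogeneity -/

section Elementary

variable {N : ℕ} {R Q : Type}

theorem projReg_smul (r : R) (a : Fin N) (c : ℂ) (φ : QState N R Q) :
    projReg r a (c • φ) = c • projReg r a φ :=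
  funext fun _ => (mul_ite_zero _ _ _).symm

theorem projQubit_smul (q : Q) (b : Bool) (c : ℂ) (φ : QState N R Q) :
    projQubit q b (c • φ) = c • projQubit q b φ :=
  funext fun _ => (mul_ite_zero _ _ _).symm

theorem branchOn_smul (b b' : Bool) (c : ℂ) (φ : QState N R Q) :
    branchOn b b' (c • φ) = c • branchOn b b' φ :=
  (smul_ite_zero _ _ _).symm

end Elementary

section Conservation

variable {M : Model} {Ask Ask' R R' Q Q' α β : Type}
  (I : Instance M) (D : SigScheme M) (orc : Ask → PMF M.Sig)

theorem Op.apply_smul (o : Op M Ask R Q) (a : o.Out) (c : ℂ) (φ : QState M.N R Q) :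
    o.apply I D orc a (c • φ) = c • o.apply I D orc a φ := by
  cases o with
  | measReg r => exact projReg_smul _ _ _ _
  | measQubit q => exact projQubit_smul _ _ _ _
  | eigTest v r => cases a <;> exact applyLocal_smul _ _ _ _ _
  | keyGen => exact smul_comm _ _ _
  | sign sk m => exact smul_comm _ _ _
  | ask q => exact smul_comm _ _ _
  | verSig vk m σ => exact branchOn_smul _ _ _ _
  | _ => exact applyLocal_smul _ _ _ _ _

/-- Every operation is linear in the state. Probabilities of earlier random outcomes, stored as
square roots in the amplitude, can therefore be pulled out as factors. -/
theorem Prog.expect_smul {F : List Ask → α → QState M.N R Q → ℝ}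
    (hF : ∀ l a (c : ℂ) φ, F l a (c • φ) = ‖c‖ ^ 2 * F l a φ) (P : Prog M Ask R Q α)
    (l : List Ask) (c : ℂ) (φ : QState M.N R Q) :
    P.expect I D orc F l (c • φ) = ‖c‖ ^ 2 * P.expect I D orc F l φ := by
  induction P generalizing l φ with
  | ret a => exact hF _ _ _ _
  | step o k ih =>
    simp only [Prog.expect, Op.apply_smul, ih, Finset.mul_sum]

theorem sum_sqrt_pmf {A : Type} [Fintype A] (μ : PMF A) :
    ∑ a, ‖((Real.sqrt (μ a).toReal : ℝ) : ℂ)‖ ^ 2 = 1 := by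
  have h : ∀ a, ‖((Real.sqrt (μ a).toReal : ℝ) : ℂ)‖ ^ 2 = (μ a).toReal := fun a => by
    rw [Complex.norm_real, Real.norm_eq_abs, sq_abs, Real.sq_sqrt ENNReal.toReal_nonneg]
  simp only [h]
  rw [← ENNReal.toReal_sum fun a _ => μ.apply_ne_top a, ← tsum_fintype (L := .unconditional _), μ.tsum_coe,
    ENNReal.toReal_one]

variable [Fintype R] [DecidableEq R] [Fintype Q] [DecidableEq Q]

theorem sum_normSq_pmf {A : Type} [Fintype A] (μ : PMF A) (φ : QState M.N R Q) :
    ∑ a, normSq (((Real.sqrt (μ a).toReal : ℝ) : ℂ) • φ) = normSq φ := by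
  simp only [normSq_smul, ← Finset.sum_mul, sum_sqrt_pmf, one_mul]

theorem sum_normSq_proj {A : Type} [Fintype A] [DecidableEq A] (f : Config M.N R Q → A)
    (φ : QState M.N R Q) :
    ∑ a, normSq (fun x => if f x = a then φ x else 0) = normSq φ := by
  simp only [normSq]
  rw [Finset.sum_comm]
  refine Finset.sum_congr rfl fun x _ => ?_
  simp only [apply_ite norm, norm_zero, ite_pow, ne_eq, OfNat.ofNat_ne_zero, not_false_eq_true,
    zero_pow, Finset.sum_ite_eq, Finset.mem_univ, if_true]

/-- Each operation is a complete measurement: unitaries with a single outcome, tests with two,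
classical sampling with one operator per value. -/
theorem Op.sum_normSq_apply (o : Op M Ask R Q) (φ : QState M.N R Q) :
    ∑ a, normSq (o.apply I D orc a φ) = normSq φ := by
  cases o with
  | gate g e q =>
    exact sum_normSq_applyLocal (ι := Unit) e.injective q.injective (fun _ => _)
      ((Fintype.sum_unique _).trans (Matrix.mem_unitaryGroup_iff'.mp (M.gateMat g).2)) φ
  | ctrlU j q r =>
    exact sum_normSq_applyLocal (ι := Unit) (injective_const_unit r) (injective_const_unit q)
      (fun _ => _) ((Fintype.sum_unique _).trans (I.ctrlMat_unitary j)) φ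
  | measReg r => exact sum_normSq_proj (fun x => x.1 r) φ
  | measQubit q => exact sum_normSq_proj (fun x => x.2 q) φ
  | bell r r' h =>
    refine sum_normSq_applyLocal (ι := Fin M.N × Fin M.N) (e := ![r, r']) ?_ injective_emptyElim _
      (sum_bellMat M.N) φ
    intro i j hij
    fin_cases i <;> fin_cases j <;> first | rfl | exact absurd hij h | exact absurd hij h.symm
  | phaseEst r => exact sum_normSq_onReg r _ I.sum_estOp φ
  | eigTest v r =>
    have h := sum_normSq_onReg r (fun b : Bool => if b then I.nearProj v else 1 - I.nearProj v) (by
      simp only [Fintype.sum_bool, if_true, Bool.false_eq_true, if_false,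
        Matrix.conjTranspose_sub, Matrix.conjTranspose_one, I.nearProj_conjTranspose, sub_mul,
        mul_sub, I.nearProj_mul_self, one_mul, mul_one]
      abel) φ
    rw [Fintype.sum_bool] at h
    exact (Fintype.sum_bool _).trans h
  | keyGen => exact sum_normSq_pmf D.gen φ
  | sign sk m => exact sum_normSq_pmf (D.sign sk m) φ
  | verSig vk m σ =>
    refine (Fintype.sum_bool _).trans ?_
    change normSq (branchOn _ true φ) + normSq (branchOn _ false φ) = _
    cases D.verify vk m σ <;> simp [branchOn, normSq_zero]
  | ask q => exact sum_normSq_pmf (orc q) φ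

theorem Prog.expect_normSq (P : Prog M Ask R Q α) (l : List Ask) (φ : QState M.N R Q) :
    P.expect I D orc (fun _ _ φ => normSq φ) l φ = normSq φ := by
  induction P generalizing l φ with
  | ret a => rfl
  | step o k ih => simp only [Prog.expect, ih, Op.sum_normSq_apply]

end Conservation

/-! ### Tensor products of states -/

section Tensor

/-- The state `φ ⊗ χ` of a memory that consists of two parts. -/
def tensor {N : ℕ} {R R' Q Q' : Type} (φ : QState N R Q) (χ : QState N R' Q') :
    QState N (R ⊕ R') (Q ⊕ Q') :=
  fun x => φ (x.1 ∘ Sum.inl, x.2 ∘ Sum.inl) * χ (x.1 ∘ Sum.inr, x.2 ∘ Sum.inr)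

theorem extend_inl_comp_inl {A B B' C : Type} {e : A → B} (he : e.Injective) (y : A → C)
    (x : B ⊕ B' → C) :
    Function.extend (Sum.inl ∘ e) y x ∘ Sum.inl = Function.extend e y (x ∘ Sum.inl) := by
  funext b
  by_cases hb : ∃ a, e a = b
  · obtain ⟨a, rfl⟩ := hb
    rw [he.extend_apply]
    exact (Sum.inl_injective.comp he).extend_apply y x a
  · rw [Function.extend_apply' _ _ _ hb]
    exact Function.extend_apply' _ _ _ fun ⟨a, ha⟩ => hb ⟨a, Sum.inl_injective ha⟩

theorem extend_inr_comp_inr {A B B' C : Type} {e : A → B'} (he : e.Injective) (y : A → C)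
    (x : B ⊕ B' → C) :
    Function.extend (Sum.inr ∘ e) y x ∘ Sum.inr = Function.extend e y (x ∘ Sum.inr) := by
  funext b
  by_cases hb : ∃ a, e a = b
  · obtain ⟨a, rfl⟩ := hb
    rw [he.extend_apply]
    exact (Sum.inr_injective.comp he).extend_apply y x a
  · rw [Function.extend_apply' _ _ _ hb]
    exact Function.extend_apply' _ _ _ fun ⟨a, ha⟩ => hb ⟨a, Sum.inr_injective ha⟩

theorem extend_inl_comp_inr {A B B' C : Type} (e : A → B) (y : A → C) (x : B ⊕ B' → C) :
    Function.extend (Sum.inl ∘ e) y x ∘ Sum.inr = x ∘ Sum.inr :=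
  funext fun _ => Function.extend_apply' _ _ _ fun ⟨_, ha⟩ => Sum.inl_ne_inr ha

theorem extend_inr_comp_inl {A B B' C : Type} (e : A → B') (y : A → C) (x : B ⊕ B' → C) :
    Function.extend (Sum.inr ∘ e) y x ∘ Sum.inl = x ∘ Sum.inl :=
  funext fun _ => Function.extend_apply' _ _ _ fun ⟨_, ha⟩ => Sum.inr_ne_inl ha

variable {N : ℕ} {R R' Q Q' K L : Type} [Fintype K] [DecidableEq K] [Fintype L] [DecidableEq L]

theorem applyLocal_tensor_left {e : K → R} {q : L → Q} (he : e.Injective) (hq : q.Injective)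
    (A : Matrix (Config N K L) (Config N K L) ℂ) (φ : QState N R Q) (χ : QState N R' Q') :
    applyLocal (Sum.inl ∘ e) (Sum.inl ∘ q) A (tensor φ χ) = tensor (applyLocal e q A φ) χ := by
  funext x
  simp only [applyLocal, tensor, extend_inl_comp_inl he, extend_inl_comp_inl hq,
    extend_inl_comp_inr, Finset.sum_mul, mul_assoc]
  rfl

theorem applyLocal_tensor_right {e : K → R'} {q : L → Q'} (he : e.Injective) (hq : q.Injective)
    (A : Matrix (Config N K L) (Config N K L) ℂ) (φ : QState N R Q) (χ : QState N R' Q') :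
    applyLocal (Sum.inr ∘ e) (Sum.inr ∘ q) A (tensor φ χ) = tensor φ (applyLocal e q A χ) := by
  funext x
  simp only [applyLocal, tensor, extend_inr_comp_inr he, extend_inr_comp_inr hq,
    extend_inr_comp_inl, Finset.mul_sum]
  exact Finset.sum_congr rfl fun y _ => mul_left_comm _ _ _

theorem emptyElim_eq_comp {A B : Type} (f : A → B) :
    (Empty.elim : Empty → B) = f ∘ Empty.elim :=
  funext fun a => a.elim

theorem onReg_tensor_left (r : R) (A : Matrix (Fin N) (Fin N) ℂ) (φ : QState N R Q)
    (χ : QState N R' Q') :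
    onReg (Sum.inl r) A (tensor φ χ) = tensor (onReg r A φ) χ := by
  rw [onReg, onReg, emptyElim_eq_comp Sum.inl]
  exact applyLocal_tensor_left (injective_const_unit r) injective_emptyElim _ φ χ

theorem onReg_tensor_right (r : R') (A : Matrix (Fin N) (Fin N) ℂ) (φ : QState N R Q)
    (χ : QState N R' Q') :
    onReg (Sum.inr r) A (tensor φ χ) = tensor φ (onReg r A χ) := by
  rw [onReg, onReg, emptyElim_eq_comp Sum.inr]
  exact applyLocal_tensor_right (injective_const_unit r) injective_emptyElim _ φ χ

theorem normSq_tensor [Fintype R] [DecidableEq R] [Fintype Q] [DecidableEq Q] [Fintype R']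
    [DecidableEq R'] [Fintype Q'] [DecidableEq Q'] (φ : QState N R Q) (χ : QState N R' Q') :
    normSq (tensor φ χ) = normSq φ * normSq χ := by
  simp only [normSq, Finset.sum_mul_sum, ← Fintype.sum_prod_type']
  refine Fintype.sum_equiv
    (((Equiv.sumArrowEquivProdArrow R R' (Fin N)).prodCongr
      (Equiv.sumArrowEquivProdArrow Q Q' Bool)).trans (Equiv.prodProdProdComm _ _ _ _)) _ _
    fun x => ?_
  rw [tensor, norm_mul, mul_pow]
  rfl

theorem smul_tensor (c : ℂ) (φ : QState N R Q) (χ : QState N R' Q') :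
    tensor (c • φ) χ = c • tensor φ χ :=
  funext fun _ => mul_assoc _ _ _

theorem tensor_smul (c : ℂ) (φ : QState N R Q) (χ : QState N R' Q') :
    tensor φ (c • χ) = c • tensor φ χ :=
  funext fun _ => mul_left_comm _ _ _

theorem zero_tensor (χ : QState N R' Q') : tensor (0 : QState N R Q) χ = 0 :=
  funext fun _ => zero_mul _

theorem tensor_zero (φ : QState N R Q) : tensor φ (0 : QState N R' Q') = 0 :=
  funext fun _ => mul_zero _

theorem projReg_tensor_left (r : R) (a : Fin N) (φ : QState N R Q) (χ : QState N R' Q') :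
    projReg (Sum.inl r) a (tensor φ χ) = tensor (projReg r a φ) χ :=
  funext fun _ => (ite_zero_mul _ _ _).symm

theorem projQubit_tensor_left (q : Q) (b : Bool) (φ : QState N R Q) (χ : QState N R' Q') :
    projQubit (Sum.inl q) b (tensor φ χ) = tensor (projQubit q b φ) χ :=
  funext fun _ => (ite_zero_mul _ _ _).symm

theorem branchOn_tensor_left (b b' : Bool) (φ : QState N R Q) (χ : QState N R' Q') :
    branchOn b b' (tensor φ χ) = tensor (branchOn b b' φ) χ := by
  unfold branchOn
  split_ifs
  · rfl
  · rw [zero_tensor]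

theorem projReg_tensor_right (r : R') (a : Fin N) (φ : QState N R Q) (χ : QState N R' Q') :
    projReg (Sum.inr r) a (tensor φ χ) = tensor φ (projReg r a χ) :=
  funext fun _ => (mul_ite_zero _ _ _).symm

theorem projQubit_tensor_right (q : Q') (b : Bool) (φ : QState N R Q) (χ : QState N R' Q') :
    projQubit (Sum.inr q) b (tensor φ χ) = tensor φ (projQubit q b χ) :=
  funext fun _ => (mul_ite_zero _ _ _).symm

theorem branchOn_tensor_right (b b' : Bool) (φ : QState N R Q) (χ : QState N R' Q') :
    branchOn b b' (tensor φ χ) = tensor φ (branchOn b b' χ) := by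
  unfold branchOn
  split_ifs
  · rfl
  · rw [tensor_zero]

end Tensor

/-! ### Programs acting on one tensor factor -/

section RelabelTensor

variable {M : Model} {Ask Ask' R R' Q Q' α : Type} (I : Instance M) (D : SigScheme M)
  {orc : Ask → PMF M.Sig} {orc' : Ask' → PMF M.Sig} {h : Ask → Ask'}

theorem vecCons_pair_comp {A B : Type} (f : A → B) (a b : A) : ![f a, f b] = f ∘ ![a, b] := by
  funext i
  fin_cases i <;> rfl

theorem injective_pair {A : Type} {a b : A} (hab : a ≠ b) : Function.Injective ![a, b] := by
  intro i j hij
  fin_cases i <;> fin_cases j <;> first | rfl | exact absurd hij hab | exact absurd hij hab.symm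

theorem Op.apply_relabel_inl (ho : ∀ a, orc' (h a) = orc a) (o : Op M Ask R Q)
    (a : (o.relabel h (Function.Embedding.inl : R ↪ R ⊕ R')
      (Function.Embedding.inl : Q ↪ Q ⊕ Q')).Out) (φ : QState M.N R Q) (χ : QState M.N R' Q') :
    (o.relabel h .inl .inl).apply I D orc' a (tensor φ χ) =
      tensor (o.apply I D orc (o.relabelOut h _ _ a) φ) χ := by
  cases o with
  | gate g e q => exact applyLocal_tensor_left e.injective q.injective _ _ _
  | ctrlU j q r =>
    exact applyLocal_tensor_left (injective_const_unit r) (injective_const_unit q) _ _ _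
  | measReg r => exact projReg_tensor_left _ _ _ _
  | measQubit q => exact projQubit_tensor_left _ _ _ _
  | bell r r' hr =>
    change applyLocal ![Sum.inl r, Sum.inl r'] Empty.elim _ _ = tensor (applyLocal _ _ _ _) _
    rw [emptyElim_eq_comp Sum.inl, vecCons_pair_comp]
    exact applyLocal_tensor_left (injective_pair hr) injective_emptyElim _ _ _
  | phaseEst r => exact onReg_tensor_left _ _ _ _
  | eigTest v r => cases a <;> exact onReg_tensor_left _ _ _ _
  | keyGen => exact (smul_tensor _ _ _).symm
  | sign sk m => exact (smul_tensor _ _ _).symm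
  | verSig vk m σ => exact branchOn_tensor_left _ _ _ _
  | ask q =>
    change ((Real.sqrt (orc' (h q) a).toReal : ℝ) : ℂ) • _ = _
    rw [ho]
    exact (smul_tensor _ _ _).symm

theorem Op.apply_relabel_inr (ho : ∀ a, orc' (h a) = orc a) (o : Op M Ask R' Q')
    (a : (o.relabel h (Function.Embedding.inr : R' ↪ R ⊕ R')
      (Function.Embedding.inr : Q' ↪ Q ⊕ Q')).Out) (φ : QState M.N R Q) (χ : QState M.N R' Q') :
    (o.relabel h .inr .inr).apply I D orc' a (tensor φ χ) =
      tensor φ (o.apply I D orc (o.relabelOut h _ _ a) χ) := by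
  cases o with
  | gate g e q => exact applyLocal_tensor_right e.injective q.injective _ _ _
  | ctrlU j q r =>
    exact applyLocal_tensor_right (injective_const_unit r) (injective_const_unit q) _ _ _
  | measReg r => exact projReg_tensor_right _ _ _ _
  | measQubit q => exact projQubit_tensor_right _ _ _ _
  | bell r r' hr =>
    change applyLocal ![Sum.inr r, Sum.inr r'] Empty.elim _ _ = tensor _ (applyLocal _ _ _ _)
    rw [emptyElim_eq_comp Sum.inr, vecCons_pair_comp]
    exact applyLocal_tensor_right (injective_pair hr) injective_emptyElim _ _ _
  | phaseEst r => exact onReg_tensor_right _ _ _ _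
  | eigTest v r => cases a <;> exact onReg_tensor_right _ _ _ _
  | keyGen => exact (tensor_smul _ _ _).symm
  | sign sk m => exact (tensor_smul _ _ _).symm
  | verSig vk m σ => exact branchOn_tensor_right _ _ _ _
  | ask q =>
    change ((Real.sqrt (orc' (h q) a).toReal : ℝ) : ℂ) • _ = _
    rw [ho]
    exact (tensor_smul _ _ _).symm

/-- By induction the second factor `χ` is never touched, so a program run inside a larger memory
behaves as it does alone. The prefix `l₀` holds queries made in the larger computation before the
program starts. -/
theorem Prog.expect_relabel_inl (ho : ∀ a, orc' (h a) = orc a)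
    (F : List Ask' → α → QState M.N (R ⊕ R') (Q ⊕ Q') → ℝ) (P : Prog M Ask R Q α)
    (l₀ : List Ask') (l : List Ask) (φ : QState M.N R Q) (χ : QState M.N R' Q') :
    (P.relabel h .inl .inl).expect I D orc' F (l₀ ++ l.map h) (tensor φ χ) =
      P.expect I D orc (fun l a φ => F (l₀ ++ l.map h) a (tensor φ χ)) l φ := by
  induction P generalizing l φ with
  | ret a => rfl
  | step o k ih =>
    refine Fintype.sum_equiv (o.relabelOut h _ _) _ _ fun a => ?_
    rw [Op.apply_relabel_inl I D ho, Op.queries_relabel, List.append_assoc, ← List.map_append, ih]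

theorem Prog.expect_relabel_inr (ho : ∀ a, orc' (h a) = orc a)
    (F : List Ask' → α → QState M.N (R ⊕ R') (Q ⊕ Q') → ℝ) (P : Prog M Ask R' Q' α)
    (l₀ : List Ask') (l : List Ask) (φ : QState M.N R Q) (χ : QState M.N R' Q') :
    (P.relabel h .inr .inr).expect I D orc' F (l₀ ++ l.map h) (tensor φ χ) =
      P.expect I D orc (fun l a χ => F (l₀ ++ l.map h) a (tensor φ χ)) l χ := by
  induction P generalizing l χ with
  | ret a => rfl
  | step o k ih =>
    refine Fintype.sum_equiv (o.relabelOut h _ _) _ _ fun a => ?_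
    rw [Op.apply_relabel_inr I D ho, Op.queries_relabel, List.append_assoc, ← List.map_append, ih]

end RelabelTensor

/-! ### Triples of registers -/

section Cube

variable {N : ℕ} {R Q : Type}

/-- The operator `A ⊗ A ⊗ A` on three registers. -/
def cubeMat (A : Matrix (Fin N) (Fin N) ℂ) :
    Matrix (Config N (Fin 3) Empty) (Config N (Fin 3) Empty) ℂ :=
  Matrix.of fun x y => ∏ i, A (x.1 i) (y.1 i)

/-- Configurations of three registers without qubits. -/
def configThree : (Fin 3 → Fin N) ≃ Config N (Fin 3) Empty := (Equiv.prodUnique _ _).symm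

theorem cubeMat_mul (A B : Matrix (Fin N) (Fin N) ℂ) :
    cubeMat A * cubeMat B = cubeMat (A * B) := by
  ext x y
  simp only [cubeMat, Matrix.mul_apply, Matrix.of_apply, ← Finset.prod_mul_distrib]
  rw [Finset.prod_univ_sum, Fintype.piFinset_univ]
  exact (Fintype.sum_equiv configThree _ _ fun z => rfl).symm

theorem cubeMat_zero : cubeMat (0 : Matrix (Fin N) (Fin N) ℂ) = 0 := by
  ext x y
  simp [cubeMat]

theorem cubeMat_conjTranspose (A : Matrix (Fin N) (Fin N) ℂ) :
    (cubeMat A).conjTranspose = cubeMat A.conjTranspose := by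
  ext x y
  simp only [cubeMat, Matrix.conjTranspose_apply, Matrix.of_apply, star_prod]

theorem sum_fin_succ_arrow {A B : Type} [Fintype A] [AddCommMonoid B] {m : ℕ}
    (f : (Fin (m + 1) → A) → B) : ∑ x, f x = ∑ a, ∑ x : Fin m → A, f (Fin.cons a x) := by
  rw [← Fintype.sum_prod_type', ← (Fin.consEquiv fun _ : Fin (m + 1) => A).sum_comp]
  rfl

theorem applyLocal_cubeMat [DecidableEq R] (e : Fin 3 ↪ R) (A : Matrix (Fin N) (Fin N) ℂ)
    (φ : QState N R Q) :
    applyLocal e (Empty.elim : Empty → Q) (cubeMat A) φ =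
      onReg (e 0) A (onReg (e 1) A (onReg (e 2) A φ)) := by
  have h01 : e 1 ≠ e 0 := e.injective.ne (by decide)
  have h02 : e 2 ≠ e 0 := e.injective.ne (by decide)
  have h12 : e 2 ≠ e 1 := e.injective.ne (by decide)
  funext x
  simp only [onReg_apply, applyLocal, extend_emptyElim, Function.update_of_ne h01,
    Function.update_of_ne h02, Function.update_of_ne h12, Finset.mul_sum]
  rw [← configThree.sum_comp]
  simp only [sum_fin_succ_arrow, Fintype.sum_unique]
  refine Finset.sum_congr rfl fun a _ => Finset.sum_congr rfl fun b _ =>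
    Finset.sum_congr rfl fun c _ => ?_
  simp only [cubeMat, Matrix.of_apply, Fin.prod_univ_three, ← mul_assoc]
  -- Writing three distinct registers at once is the same as writing them one after another.
  have hx : Function.extend e (Fin.cons a (Fin.cons b (Fin.cons c default)) : Fin 3 → Fin N) x.1 =
      Function.update (Function.update (Function.update x.1 (e 0) a) (e 1) b) (e 2) c := by
    funext r
    by_cases hr : ∃ i, e i = r
    · obtain ⟨i, rfl⟩ := hr
      rw [e.injective.extend_apply]
      fin_cases i
      · simp
      · simp
      · simp; rfl
    · rw [Function.extend_apply' _ _ _ hr]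
      have : ∀ i, r ≠ e i := fun i h => hr ⟨i, h.symm⟩
      rw [Function.update_of_ne (this 2), Function.update_of_ne (this 1),
        Function.update_of_ne (this 0)]
  exact congrArg₂ (· * ·) rfl (congrArg φ (Prod.ext hx rfl))

end Cube

/-! ### Testing three registers against one serial number -/

section Triple

variable {M : Model} {Ask R Q : Type} (I : Instance M) (D : SigScheme M) (orc : Ask → PMF M.Sig)

/-- The state after all of the registers `e` have passed the test against `v`. -/
def tripleTest (v : M.Ser) (e : Fin 3 ↪ R) (φ : QState M.N R Q) : QState M.N R Q :=
  onReg (e 0) (I.nearProj v) (onReg (e 1) (I.nearProj v) (onReg (e 2) (I.nearProj v) φ))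

/-- The program that tests the registers `e` against `v`. -/
def tripleTestProg (v : M.Ser) (e : Fin 3 ↪ R) : Prog M Ask R Q Bool :=
  .step (.eigTest v (e 2)) fun (b₂ : Bool) =>
    .step (.eigTest v (e 1)) fun (b₁ : Bool) =>
      .step (.eigTest v (e 0)) fun (b₀ : Bool) => .ret (b₂ && b₁ && b₀)

theorem cost_tripleTestProg_le (v : M.Ser) (e : Fin 3 ↪ R) :
    (tripleTestProg v e : Prog M Ask R Q Bool).cost ≤ 3 * M.costTest := by
  refine (Prog.cost_step_le _ _ _ fun b₂ => Prog.cost_step_le _ _ _ fun b₁ =>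
    Prog.cost_step_le _ _ 0 fun b₀ => le_rfl).trans (le_of_eq ?_)
  simp only [Op.cost]
  ring

/-- Of the eight branches only the one with three positive outcomes counts, and it carries the
projected state. -/
theorem expect_tripleTestProg (v : M.Ser) (e : Fin 3 ↪ R) (H : QState M.N R Q → ℝ)
    (l : List Ask) (φ : QState M.N R Q) :
    (tripleTestProg v e).expect I D orc (fun _ b φ => if b then H φ else 0) l φ =
      H (tripleTest I v e φ) := by
  refine (Fintype.sum_bool _).trans ?_
  refine (congrArg₂ (· + ·) (Fintype.sum_bool _) (Fintype.sum_bool _)).trans ?_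
  refine (congrArg₂ (· + ·) (congrArg₂ (· + ·) (Fintype.sum_bool _) (Fintype.sum_bool _))
    (congrArg₂ (· + ·) (Fintype.sum_bool _) (Fintype.sum_bool _))).trans ?_
  simp only [Prog.expect, Bool.and_true, Bool.and_false, Bool.false_eq_true, if_false, add_zero,
    if_true]
  rfl

theorem tripleTest_eq [DecidableEq R] (v : M.Ser) (e : Fin 3 ↪ R) (φ : QState M.N R Q) :
    tripleTest I v e φ =
      applyLocal e (Empty.elim : Empty → Q) (cubeMat (I.nearProj v)) φ :=
  (applyLocal_cubeMat e _ φ).symm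

/-- The threefold test is zero or a single summand of the projection onto triple eigenstates, whose
summands are mutually orthogonal. -/
theorem sum_cubeMat_mul (v : M.Ser) :
    (∑ k, cubeMat (I.proj k)) * cubeMat (I.nearProj v) = cubeMat (I.nearProj v) ∧
      cubeMat (I.nearProj v) * (∑ k, cubeMat (I.proj k)) = cubeMat (I.nearProj v) := by
  rcases I.nearProj_cases v with h | ⟨k, h⟩ <;> rw [h]
  · simp only [cubeMat_zero, mul_zero, zero_mul, and_self]
  · simp only [Finset.sum_mul, Finset.mul_sum, cubeMat_mul, I.proj_mul_proj,
      apply_ite cubeMat, cubeMat_zero, Finset.sum_ite_eq, Finset.sum_ite_eq', Finset.mem_univ,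
      if_true, and_self]

variable [Fintype R] [DecidableEq R] [Fintype Q] [DecidableEq Q]

theorem tripleWeight_eq (e : Fin 3 ↪ R) (φ : QState M.N R Q) :
    tripleWeight I e φ =
      normSq (applyLocal e (Empty.elim : Empty → Q) (∑ k, cubeMat (I.proj k)) φ) := by
  have : (∑ k, cubeMat (I.proj k)) =
      Matrix.of fun x y => ∑ k, ∏ i, I.proj k (x.1 i) (y.1 i) := by
    ext x y
    simp only [Matrix.sum_apply, cubeMat, Matrix.of_apply]
  rw [this]; rfl

theorem tripleWeight_nonneg (e : Fin 3 ↪ R) (φ : QState M.N R Q) : 0 ≤ tripleWeight I e φ :=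
  normSq_nonneg _

/-- A state that has passed all three tests already lies in the range of the projection onto triple
eigenstates, so an announced success is a genuine one. -/
theorem tripleWeight_tripleTest (v : M.Ser) (e : Fin 3 ↪ R) (φ : QState M.N R Q) :
    tripleWeight I e (tripleTest I v e φ) = normSq (tripleTest I v e φ) := by
  rw [tripleWeight_eq, tripleTest_eq, applyLocal_mul e.injective injective_emptyElim,
    (sum_cubeMat_mul I v).1]

/-- The test absorbs the projection onto triple eigenstates, so it may be applied after that
projection, where it can only lose norm. An algorithm that outputs the registers untested thus does
at least as well. -/
theorem normSq_tripleTest_le (v : M.Ser) (e : Fin 3 ↪ R) (φ : QState M.N R Q) :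
    normSq (tripleTest I v e φ) ≤ tripleWeight I e φ := by
  rw [tripleWeight_eq, tripleTest_eq, ← (sum_cubeMat_mul I v).2,
    ← applyLocal_mul e.injective injective_emptyElim]
  refine normSq_applyLocal_le e.injective injective_emptyElim ?_ ?_ _
  · rw [cubeMat_conjTranspose, I.nearProj_conjTranspose]
  · rw [cubeMat_mul, I.nearProj_mul_self]

theorem tripleWeight_tensor_left {R' Q' : Type} [Fintype R'] [DecidableEq R'] [Fintype Q']
    [DecidableEq Q'] (e : Fin 3 ↪ R) (φ : QState M.N R Q) (χ : QState M.N R' Q') :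
    tripleWeight I (e.trans .inl) (tensor φ χ) = tripleWeight I e φ * normSq χ := by
  rw [tripleWeight, tripleWeight, emptyElim_eq_comp Sum.inl, ← normSq_tensor]
  exact congrArg normSq (applyLocal_tensor_left e.injective injective_emptyElim _ _ _)

theorem tripleWeight_tensor_right {R' Q' : Type} [Fintype R'] [DecidableEq R'] [Fintype Q']
    [DecidableEq Q'] (e : Fin 3 ↪ R') (φ : QState M.N R Q) (χ : QState M.N R' Q') :
    tripleWeight I (e.trans .inr) (tensor φ χ) = normSq φ * tripleWeight I e χ := by
  rw [tripleWeight, tripleWeight, emptyElim_eq_comp Sum.inr, ← normSq_tensor]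
  exact congrArg normSq (applyLocal_tensor_right e.injective injective_emptyElim _ _ _)

end Triple

/-! ### Acceptance of bills -/

section Acceptance

variable {M : Model} {Ask R Q : Type} {m : ℕ} (I : Instance M) (D : SigScheme M)
  (orc : Ask → PMF M.Sig)

/-- The state after the half `c` of a note has passed its test. -/
def Bills.test (x : Bills M m R) (c : Fin m ⊕ Fin m) (φ : QState M.N R Q) : QState M.N R Q :=
  onReg (Sum.elim x.left x.right c) (I.nearProj (Sum.elim x.serial x.serial c)) φ

/-- The state after the bills with indices in a list have passed their tests. -/
def Bills.testList (x : Bills M m R) : List (Fin m) → QState M.N R Q → QState M.N R Q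
  | [], φ => φ
  | i :: is, φ => x.testList is (x.test I (.inr i) (x.test I (.inl i) φ))

theorem Bills.testList_cons (x : Bills M m R) (i : Fin m) (is : List (Fin m))
    (φ : QState M.N R Q) :
    x.testList I (i :: is) φ = x.testList I is (x.test I (.inr i) (x.test I (.inl i) φ)) := by
  rw [testList]

theorem Bills.test_zero (x : Bills M m R) (c : Fin m ⊕ Fin m) :
    x.test I c (0 : QState M.N R Q) = 0 :=
  onReg_zero _ _

theorem Bills.testList_zero (x : Bills M m R) (is : List (Fin m)) :
    x.testList I is (0 : QState M.N R Q) = 0 := by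
  induction is with
  | nil => rfl
  | cons i is ih => rw [testList_cons, test_zero, test_zero, ih]

theorem Bills.test_test_self (x : Bills M m R) (c : Fin m ⊕ Fin m) (φ : QState M.N R Q) :
    x.test I c (x.test I c φ) = x.test I c φ := by
  rw [test, test, onReg_onReg, I.nearProj_mul_self]

theorem Bills.test_comm (x : Bills M m R) (c c' : Fin m ⊕ Fin m)
    (φ : QState M.N R Q) : x.test I c (x.test I c' φ) = x.test I c' (x.test I c φ) := by
  classical
  by_cases h : c = c'
  · rw [h]
  · exact onReg_comm (x.distinct.ne h) _ _ _

/-- The tests are commuting idempotents, so an extra test moves along the list until it meets its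
own copy and is absorbed. -/
theorem Bills.testList_test (x : Bills M m R) (is : List (Fin m))
    {c : Fin m ⊕ Fin m} (hc : Sum.elim id id c ∈ is) (φ : QState M.N R Q) :
    x.testList I is (x.test I c φ) = x.testList I is φ := by
  induction is generalizing φ with
  | nil => exact absurd hc List.not_mem_nil
  | cons i is ih =>
    rw [testList_cons, testList_cons]
    rcases List.mem_cons.mp hc with h | h
    · refine congrArg (x.testList I is) ?_
      rcases c with j | j <;> obtain rfl : j = i := h
      · exact congrArg _ (x.test_test_self I _ φ)
      · rw [x.test_comm I (.inl j), test_test_self]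
    · refine Eq.trans (congrArg (x.testList I is) ?_) (ih h _)
      rw [x.test_comm I (.inl i), x.test_comm I (.inr i)]

/-- If the signature is rejected, the accepting branch still exists in the program tree but carries
the zero state; hence the need for `H 0 = 0`. -/
theorem expect_verify (vk : M.VK) (r r' : R) (v : M.Ser) (σ : M.Sig) {H : QState M.N R Q → ℝ}
    (hH : H 0 = 0) (l : List Ask) (φ : QState M.N R Q) :
    (verify vk r r' v σ).expect I D orc (fun _ b φ => if b then H φ else 0) l φ =
      if D.verify vk v σ then H (onReg r' (I.nearProj v) (onReg r (I.nearProj v) φ)) else 0 := by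
  refine (Fintype.sum_bool _).trans ?_
  refine (congrArg₂ (· + ·) (Fintype.sum_bool _) (Fintype.sum_bool _)).trans ?_
  refine (congrArg₂ (· + ·) (congrArg₂ (· + ·) (Fintype.sum_bool _) (Fintype.sum_bool _))
    (congrArg₂ (· + ·) (Fintype.sum_bool _) (Fintype.sum_bool _))).trans ?_
  simp only [Prog.expect, Bool.and_true, Bool.and_false, Bool.false_eq_true, if_false, add_zero,
    if_true]
  change H (onReg r' _ (onReg r _ (branchOn (D.verify vk v σ) true φ))) = _
  cases D.verify vk v σ
  · simp only [branchOn, Bool.false_eq_true, if_false, onReg_zero, hH]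
  · rfl

theorem expect_verifyList (vk : M.VK) (x : Bills M m R) (is : List (Fin m))
    {H : QState M.N R Q → ℝ} (hH : H 0 = 0) (l : List Ask) (φ : QState M.N R Q) :
    (verifyList vk x is).expect I D orc (fun _ b φ => if b then H φ else 0) l φ =
      if ∀ i ∈ is, D.verify vk (x.serial i) (x.sig i) = true then H (x.testList I is φ) else 0 := by
  induction is generalizing l φ with
  | nil => simp [verifyList, Prog.expect, Bills.testList]
  | cons i is ih =>
    rw [verifyList, Prog.expect_bind]
    have h : (fun (l : List Ask) (b : Bool) (φ : QState M.N R Q) =>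
        ((verifyList vk x is).bind fun b' => Prog.ret (b && b')).expect I D orc
          (fun _ b φ => if b then H φ else 0) l φ) = fun _ b φ =>
          if b then (if ∀ i ∈ is, D.verify vk (x.serial i) (x.sig i) = true then
            H (x.testList I is φ) else 0) else 0 := by
      funext l b φ
      rw [Prog.expect_bind]
      cases b
      · simp only [Prog.expect, Bool.false_and, Bool.false_eq_true, if_false, Prog.expect_zero]
      · simp only [Prog.expect, Bool.true_and, if_true]
        exact ih l φ
    rw [h, expect_verify I D orc vk _ _ _ _ (by rw [Bills.testList_zero, hH, ite_self])]
    simp only [List.forall_mem_cons, Bills.testList]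
    split_ifs <;> first | rfl | simp_all

variable [Fintype R] [DecidableEq R] [Fintype Q] [DecidableEq Q]

theorem Bills.normSq_testList_le (x : Bills M m R) (is : List (Fin m)) (φ : QState M.N R Q) :
    normSq (x.testList I is φ) ≤ normSq φ := by
  induction is generalizing φ with
  | nil => exact le_rfl
  | cons i is ih =>
    refine (ih _).trans ?_
    refine (normSq_onReg_le _ (I.nearProj_conjTranspose _) (I.nearProj_mul_self _) _).trans ?_
    exact normSq_onReg_le _ (I.nearProj_conjTranspose _) (I.nearProj_mul_self _) _

/-- The probability weight with which all the bills pass verification. -/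
def Bills.passWeight (vk : M.VK) (x : Bills M m R) (φ : QState M.N R Q) : ℝ :=
  if ∀ i, D.verify vk (x.serial i) (x.sig i) = true then
    normSq (x.testList I (List.finRange m) φ) else 0

theorem Bills.passWeight_eq (vk : M.VK) (x : Bills M m R) (φ : QState M.N R Q) :
    x.passWeight I D vk φ = (verifyAll vk x).expect I D orc acceptWeight [] φ := by
  refine Eq.trans ?_
    (expect_verifyList I D orc vk x (List.finRange m) (H := normSq) normSq_zero [] φ).symm
  simp only [passWeight, List.mem_finRange, true_imp_iff]

theorem Bills.passWeight_eq_zero {vk : M.VK} {x : Bills M m R} {i : Fin m}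
    (h : D.verify vk (x.serial i) (x.sig i) ≠ true) (φ : QState M.N R Q) :
    x.passWeight I D vk φ = 0 :=
  if_neg fun h' => h (h' i)

theorem Bills.passWeight_le (vk : M.VK) (x : Bills M m R) (φ : QState M.N R Q) :
    x.passWeight I D vk φ ≤ normSq φ := by
  unfold passWeight
  split_ifs
  exacts [x.normSq_testList_le I _ φ, normSq_nonneg _]

theorem Bills.passWeight_test (vk : M.VK) (x : Bills M m R) (c : Fin m ⊕ Fin m)
    (φ : QState M.N R Q) : x.passWeight I D vk (x.test I c φ) = x.passWeight I D vk φ := by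
  unfold passWeight
  rw [x.testList_test I _ (List.mem_finRange _)]

/-- Both halves of the note `i` and one half of the note `j`. -/
def Bills.triple (x : Bills M m R) {i j : Fin m} (h : i ≠ j) : Fin 3 ↪ R where
  toFun := Sum.elim x.left x.right ∘ ![.inl i, .inr i, .inl j]
  inj' := x.distinct.comp fun a b hab => by
    fin_cases a <;> fin_cases b <;> first | rfl | simp [h, h.symm] at hab

/-- Three of the tests in the verification can be carried out in advance at no loss. They are tests
against the same serial number, and what remains only decreases the norm. -/
theorem Bills.passWeight_le_tripleTest (vk : M.VK) (x : Bills M m R) {i j : Fin m} (h : i ≠ j)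
    (hs : x.serial i = x.serial j) (φ : QState M.N R Q) :
    x.passWeight I D vk φ ≤ normSq (tripleTest I (x.serial i) (x.triple h) φ) := by
  have : tripleTest I (x.serial i) (x.triple h) φ =
      x.test I (.inl i) (x.test I (.inr i) (x.test I (.inl j) φ)) := by
    simp only [tripleTest, Bills.test, Sum.elim_inl, Sum.elim_inr, ← hs]
    rfl
  rw [this, ← x.passWeight_test I D vk (.inl j) φ, ← x.passWeight_test I D vk (.inr i),
    ← x.passWeight_test I D vk (.inl i)]
  exact x.passWeight_le I D vk _

end Acceptance

/-! ### The initial memory -/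

section ZeroState

variable {N : ℕ} [NeZero N] {R R' Q Q' : Type}

open Classical in
/-- The state in which all registers and qubits are zero. -/
def zeroState (N : ℕ) [NeZero N] (R Q : Type) : QState N R Q :=
  fun x => if (∀ r, x.1 r = 0) ∧ (∀ q, x.2 q = false) then 1 else 0

theorem tensor_zeroState :
    tensor (zeroState N R Q) (zeroState N R' Q') = zeroState N (R ⊕ R') (Q ⊕ Q') := by
  funext x
  have hx : ((∀ r, x.1 r = 0) ∧ (∀ q, x.2 q = false)) ↔
      ((∀ r, x.1 (.inl r) = 0) ∧ (∀ q, x.2 (.inl q) = false)) ∧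
        ((∀ r, x.1 (.inr r) = 0) ∧ (∀ q, x.2 (.inr q) = false)) := by
    rw [Sum.forall, Sum.forall]
    tauto
  simp only [tensor, zeroState, Function.comp_apply, hx]
  split_ifs <;> simp_all

theorem normSq_zeroState [Fintype R] [DecidableEq R] [Fintype Q] [DecidableEq Q] :
    normSq (zeroState N R Q) = 1 := by
  have : ∀ x : Config N R Q, ‖zeroState N R Q x‖ ^ 2 =
      if x = ((fun _ => 0), fun _ => false) then 1 else 0 := fun x => by
    by_cases h : (∀ r, x.1 r = 0) ∧ (∀ q, x.2 q = false)
    · rw [zeroState, if_pos h, if_pos (Prod.ext (funext h.1) (funext h.2))]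
      simp
    · rw [zeroState, if_neg h, if_neg fun h' => h ⟨by simp [h'], by simp [h']⟩]
      simp
  simp only [normSq, this, Finset.sum_ite_eq', Finset.mem_univ, if_true]

theorem init_eq_zeroState {M : Model} {Ask In : Type} {Out : Type → Type}
    (A : Alg M Ask In 0 Out) (I : Instance M) (k : Fin 0 → Fin M.N) :
    A.init I k = zeroState M.N A.R A.Q := by
  funext x
  have : ∀ r, r ∉ Set.range A.inReg := fun r ⟨p, _⟩ => p.1.elim0
  simp only [Alg.init, zeroState, this, not_false_eq_true, true_imp_iff,
    Finset.univ_eq_empty, Finset.prod_empty]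
  congr

end ZeroState

/-! ### Repeating an attempt -/

section Repeat

variable {M : Model} {In R Q : Type}

theorem list_eq_nil_of_isEmpty {A : Type} [IsEmpty A] (l : List A) : l = [] :=
  List.eq_nil_of_subset_nil fun a => isEmptyElim a

/-- The solver that outputs three registers without doing anything. -/
def Solver.idle (M : Model) (In : Type) : Solver M In where
  R := Fin 3
  Q := Empty
  finR := inferInstance
  decR := inferInstance
  finQ := inferInstance
  decQ := inferInstance
  inReg := ⟨fun p => p.1.elim0, fun p => p.1.elim0⟩
  prog _ := .ret (.refl _)

/-- Run the program `P` and, if it does not find three registers, the program `P'` in another part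
of the memory. -/
def Prog.orElse {R' Q' : Type} (P : Prog M Empty R Q (Option (Fin 3 ↪ R)))
    (P' : Prog M Empty R' Q' (Fin 3 ↪ R')) :
    Prog M Empty (R ⊕ R') (Q ⊕ Q') (Fin 3 ↪ R ⊕ R') :=
  (P.relabel id .inl .inl).bind fun o =>
    o.elim ((P'.relabel id .inr .inr).bind fun e => .ret (e.trans .inr))
      fun e => .ret (e.trans .inl)

theorem Prog.cost_orElse_le {R' Q' : Type} (P : Prog M Empty R Q (Option (Fin 3 ↪ R)))
    (P' : Prog M Empty R' Q' (Fin 3 ↪ R')) : (P.orElse P').cost ≤ P.cost + P'.cost := by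
  refine (Prog.cost_bind_le _ _ P'.cost fun o => ?_).trans
    (Nat.add_le_add_right (Prog.cost_relabel_le _ _ _ _) _)
  cases o with
  | some e => exact Nat.zero_le _
  | none =>
    exact (Prog.cost_bind_le _ _ 0 fun e => le_rfl).trans (Prog.cost_relabel_le _ _ _ _)

/-- Test the registers that the program `P` has found, if any. -/
def attempt (P : Prog M Empty R Q (Option (M.Ser × (Fin 3 ↪ R)))) :
    Prog M Empty R Q (Option (Fin 3 ↪ R)) :=
  P.bind fun o => o.elim (.ret none) fun c =>
    (tripleTestProg c.1 c.2).bind fun b => .ret (if b then some c.2 else none)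

theorem cost_attempt_le (P : Prog M Empty R Q (Option (M.Ser × (Fin 3 ↪ R)))) :
    (attempt P).cost ≤ P.cost + 3 * M.costTest := by
  refine Prog.cost_bind_le _ _ _ fun o => ?_
  cases o with
  | none => exact Nat.zero_le _
  | some c =>
    exact (Prog.cost_bind_le _ _ 0 fun b => le_rfl).trans (cost_tripleTestProg_le c.1 c.2)

variable [Fintype R] [DecidableEq R] [Fintype Q] [DecidableEq Q]

/-- A failed attempt leaves its own memory in an arbitrary state `φ`, but the other part is still
zero. The second program then succeeds with its usual probability, weighted by `normSq φ`. -/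
theorem Prog.expect_orElse {R' Q' : Type} [Fintype R'] [DecidableEq R'] [Fintype Q']
    [DecidableEq Q'] (I : Instance M) (D : SigScheme M)
    (P : Prog M Empty R Q (Option (Fin 3 ↪ R)))
    (P' : Prog M Empty R' Q' (Fin 3 ↪ R')) :
    (P.orElse P').expect I D (fun a => a.elim) (fun _ e φ => tripleWeight I e φ) []
      (zeroState M.N (R ⊕ R') (Q ⊕ Q')) =
    P.expect I D (fun a => a.elim) (fun _ o φ => o.elim
      (P'.expect I D (fun a => a.elim) (fun _ e φ => tripleWeight I e φ) []
        (zeroState M.N R' Q') * normSq φ) fun e => tripleWeight I e φ) [] (zeroState M.N R Q) := by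
  rw [Prog.orElse, Prog.expect_bind, ← tensor_zeroState]
  refine (Prog.expect_relabel_inl I D (orc := fun a => a.elim) (fun a => rfl) _ P [] []
    _ _).trans ?_
  congr 1
  funext l o φ
  rw [list_eq_nil_of_isEmpty l]
  cases o with
  | some e =>
    refine (tripleWeight_tensor_left I e φ (zeroState M.N R' Q')).trans ?_
    rw [normSq_zeroState, mul_one]; rfl
  | none =>
    rw [Option.elim_none, Option.elim_none, Prog.expect_bind]
    refine (Prog.expect_relabel_inr I D (orc := fun a => a.elim) (fun a => rfl) _ P' [] []
      _ _).trans ?_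
    rw [mul_comm, ← Prog.expect_const_mul]
    congr 1
    funext l e χ
    exact tripleWeight_tensor_right I e φ χ

/-- Run the attempt `P` and, if it fails, the solver `B` in a fresh part of the memory. -/
def Solver.orElse (P : In → Prog M Empty R Q (Option (Fin 3 ↪ R))) (B : Solver M In) :
    Solver M In where
  R := R ⊕ B.R
  Q := Q ⊕ B.Q
  finR := inferInstance
  decR := inferInstance
  finQ := inferInstance
  decQ := inferInstance
  inReg := ⟨fun p => p.1.elim0, fun p => p.1.elim0⟩
  prog x := (P x).orElse (B.prog x)

/-- Repeat the attempt `P` up to `m` times, each time in a fresh part of the memory. -/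
def Solver.iterate (P : In → Prog M Empty R Q (Option (Fin 3 ↪ R))) : ℕ → Solver M In
  | 0 => Solver.idle M In
  | m + 1 => Solver.orElse P (Solver.iterate P m)

theorem Solver.cost_iterate_le {P : In → Prog M Empty R Q (Option (Fin 3 ↪ R))} {c : ℕ}
    (hP : ∀ x, (P x).cost ≤ c) (m : ℕ) (x : In) : ((Solver.iterate P m).prog x).cost ≤ m * c := by
  induction m with
  | zero => exact Nat.zero_le _
  | succ m ih =>
    refine (Prog.cost_orElse_le (P x) ((Solver.iterate P m).prog x)).trans ?_
    rw [Nat.succ_mul, add_comm]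
    exact Nat.add_le_add ih (hP x)

variable (I : Instance M) (D : SigScheme M)

theorem Solver.prob_nonneg (B : Solver M In) (x : In) : 0 ≤ B.prob I D x := by
  rw [← Prog.expect_zero I D (fun a : Empty => a.elim) (B.prog x) [] (B.init I Fin.elim0)]
  exact Prog.expect_mono I D _ (fun _ _ _ => tripleWeight_nonneg I _ _) _ _ _

theorem Solver.prob_orElse (P : In → Prog M Empty R Q (Option (Fin 3 ↪ R))) (B : Solver M In)
    (x : In) :
    (Solver.orElse P B).prob I D x = (P x).expect I D (fun a => a.elim)
      (fun _ o φ => o.elim (B.prob I D x * normSq φ) fun e => tripleWeight I e φ) []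
      (zeroState M.N R Q) := by
  rw [Solver.prob, Solver.prob, init_eq_zeroState, init_eq_zeroState]
  exact Prog.expect_orElse I D (P x) (B.prog x)

/-- In the hypothesis `q` is the value of the fallback after a failure. Taking for it the bound for
`m` attempts gives the bound for `m + 1`, since the failure bound is multiplied by `1 - s`. -/
theorem Solver.le_prob_iterate {P : In → Prog M Empty R Q (Option (Fin 3 ↪ R))} {s : ℝ}
    (hs : s ≤ 1) {x : In}
    (hP : ∀ q ≤ 1, q + (1 - q) * s ≤ (P x).expect I D (fun a => a.elim)
      (fun _ o φ => o.elim (q * normSq φ) fun e => tripleWeight I e φ) [] (zeroState M.N R Q))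
    (m : ℕ) : 1 - (1 - s) ^ m ≤ (Solver.iterate P m).prob I D x := by
  induction m with
  | zero =>
    rw [pow_zero, sub_self]
    exact Solver.prob_nonneg I D _ x
  | succ m ih =>
    have h0 : 0 ≤ (1 - s) ^ m := pow_nonneg (sub_nonneg.mpr hs) m
    rw [Solver.iterate, Solver.prob_orElse]
    refine le_trans (le_of_eq ?_) ((hP (1 - (1 - s) ^ m) (by linarith)).trans
      (Prog.expect_mono I D _ (fun l o φ => ?_) _ _ _))
    · ring
    · cases o with
      | some e => exact le_rfl
      | none => exact mul_le_mul_of_nonneg_right ih (normSq_nonneg φ)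

/-- The chain is `(1 - s) ^ m ≤ exp (-s m) ≤ exp (-1) ≤ 1 / 2`. -/
theorem half_le_one_sub_pow {s : ℝ} (hs : s ≤ 1) {m : ℕ} (hm : 1 ≤ s * m) :
    1 / 2 ≤ 1 - (1 - s) ^ m := by
  have h1 : (1 - s) ^ m ≤ Real.exp (-s) ^ m :=
    pow_le_pow_left₀ (sub_nonneg.mpr hs) (Real.one_sub_le_exp_neg s) m
  have h2 : Real.exp (-s) ^ m ≤ Real.exp (-1) := by
    rw [← Real.exp_nat_mul]
    exact Real.exp_le_exp.mpr (by linarith)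
  have h3 : Real.exp (-1) ≤ 1 / 2 := by
    rw [Real.exp_neg, ← one_div]
    exact one_div_le_one_div_of_le two_pos (by linarith [Real.add_one_le_exp (1 : ℝ)])
  linarith

/-- Give every branch the fallback value `q`. A passed test is worth the full weight instead, a gain
of `1 - q` per unit of weight, and tests pass with total weight at least `s`. -/
theorem le_expect_attempt {P : Prog M Empty R Q (Option (M.Ser × (Fin 3 ↪ R)))} {s q : ℝ}
    (hq : q ≤ 1) {φ : QState M.N R Q} (hφ : normSq φ = 1)
    (hs : s ≤ P.expect I D (fun a => a.elim)
      (fun _ o φ => o.elim 0 fun c => normSq (tripleTest I c.1 c.2 φ)) [] φ) :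
    q + (1 - q) * s ≤ (attempt P).expect I D (fun a => a.elim)
      (fun _ o φ => o.elim (q * normSq φ) fun e => tripleWeight I e φ) [] φ := by
  have h : (attempt P).expect I D (fun a => a.elim)
      (fun _ o φ => o.elim (q * normSq φ) fun e => tripleWeight I e φ) [] φ =
      P.expect I D (fun a => a.elim) (fun _ o φ => q * normSq φ +
        (1 - q) * o.elim 0 fun c => normSq (tripleTest I c.1 c.2 φ)) [] φ := by
    rw [attempt, Prog.expect_bind]
    congr 1
    funext l o φ
    cases o with
    | none => simp only [Option.elim_none, mul_zero, add_zero, Prog.expect]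
    | some c =>
      rw [Option.elim_some, Option.elim_some, Prog.expect_bind]
      have hF : (fun (l : List Empty) (b : Bool) (φ : QState M.N R Q) =>
          (Prog.ret (if b then some c.2 else none) :
            Prog M Empty R Q (Option (Fin 3 ↪ R))).expect I D (fun a => a.elim)
            (fun _ o φ => o.elim (q * normSq φ) fun e => tripleWeight I e φ) l φ) =
          fun _ b φ => q * normSq φ +
            if b then tripleWeight I c.2 φ - q * normSq φ else 0 := by
        funext l b φ
        cases b <;> simp [Prog.expect]
      rw [hF, Prog.expect_add, Prog.expect_const_mul, Prog.expect_normSq, expect_tripleTestProg,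
        tripleWeight_tripleTest]
      ring
  rw [h, Prog.expect_add, Prog.expect_const_mul, Prog.expect_const_mul, Prog.expect_normSq, hφ,
    mul_one]
  exact add_le_add_right (mul_le_mul_of_nonneg_left hs (by linarith)) q

end Repeat

/-! ### Attacks by the mint -/

section MintAttack

variable {M : Model} {n : ℕ} (A : MintAttack M n)

open Classical in
/-- Two equal serial numbers among given bills, and three registers that should then contain the
same eigenvector. -/
def Bills.findRepeated {R : Type} {m : ℕ} (x : Bills M m R) : Option (M.Ser × (Fin 3 ↪ R)) :=
  if h : ∃ p : Fin m × Fin m, p.1 ≠ p.2 ∧ x.serial p.1 = x.serial p.2 then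
    some (x.serial h.choose.1, x.triple h.choose_spec.1) else none

theorem Bills.exists_repeated {R : Type} (x : Bills M (n + 1) R)
    (h : (Finset.univ.image x.serial).card ≤ n) :
    ∃ p : Fin (n + 1) × Fin (n + 1), p.1 ≠ p.2 ∧ x.serial p.1 = x.serial p.2 := by
  by_contra hne
  have hinj : Function.Injective x.serial := fun i j hij => by
    by_contra hij'
    exact hne ⟨(i, j), hij', hij⟩
  rw [Finset.card_image_of_injective _ hinj, Finset.card_univ, Fintype.card_fin] at h
  omega

/-- On each branch either there are too many serial numbers and nothing is counted, or a repeated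
one exists and its triple passes with at least the weight of acceptance. -/
theorem MintAttack.prob_le (I : Instance M) (D : SigScheme M) (vk : M.VK) (sk : M.SK) :
    A.prob I D vk sk ≤
      ((A.prog (vk, sk)).bind fun x => .ret x.findRepeated).expect I D (fun a => a.elim)
        (fun _ o φ => o.elim 0 fun c => normSq (tripleTest I c.1 c.2 φ)) []
        (zeroState M.N A.R A.Q) := by
  rw [MintAttack.prob, Prog.expect_bind, Prog.expect_bind, init_eq_zeroState]
  refine Prog.expect_mono I D _ (fun l x φ => ?_) _ _ _
  rw [list_eq_nil_of_isEmpty l, Prog.expect_bind]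
  by_cases hc : (Finset.univ.image x.serial).card ≤ n
  · have hx := x.exists_repeated hc
    have : (fun (l : List Empty) (b : Bool) (φ : QState M.N A.R A.Q) =>
        (Prog.ret (b && decide ((Finset.univ.image x.serial).card ≤ n)) :
          Prog M Empty A.R A.Q Bool).expect I D (fun a => a.elim) acceptWeight l φ) =
        acceptWeight := by
      funext l b φ
      simp only [Prog.expect, decide_eq_true hc, Bool.and_true]
    rw [this, ← Bills.passWeight_eq]
    simp only [Prog.expect, Bills.findRepeated, dif_pos hx, Option.elim_some]
    exact x.passWeight_le_tripleTest I D vk hx.choose_spec.1 hx.choose_spec.2 φ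
  · have : (fun (l : List Empty) (b : Bool) (φ : QState M.N A.R A.Q) =>
        (Prog.ret (b && decide ((Finset.univ.image x.serial).card ≤ n)) :
          Prog M Empty A.R A.Q Bool).expect I D (fun a => a.elim) acceptWeight l φ) =
        fun _ _ _ => 0 := by
      funext l b φ
      simp only [Prog.expect, decide_eq_false hc, Bool.and_false, acceptWeight,
        Bool.false_eq_true, if_false]
    rw [this, Prog.expect_zero]
    simp only [Prog.expect]
    cases x.findRepeated with
    | none => exact le_rfl
    | some c => exact normSq_nonneg _

/-- Rounding up adds at most `1`, which is at most `1 / p`. -/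
theorem ceil_div_le {a p : ℝ} (ha : 1 ≤ a) (hp : 0 < p) (hp1 : p ≤ 1) :
    (⌈a / p⌉₊ : ℝ) ≤ (a + 1) / p := by
  have h := (Nat.ceil_lt_add_one (a := a / p) (by positivity)).le
  have h1 : 1 ≤ 1 / p := (one_le_div hp).mpr hp1
  rw [add_div]
  linarith

theorem exists_solver_of_mintAttack (T : ℕ) {p : ℝ} (hp : 0 < p) (hp1 : p ≤ 1)
    (hA : A.RunsIn T) :
    ∃ B : Solver M (M.VK × M.SK), B.RunsIn (4 * ((T + M.verifyTime) / p)) ∧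
      ∀ (I : Instance M) (D : SigScheme M) (vk : M.VK) (sk : M.SK),
        p ≤ A.prob I D vk sk → 1 / 2 ≤ B.prob I D (vk, sk) := by
  -- With success probability `p` per attempt, `⌈1 / p⌉₊` attempts suffice; rounding makes this at
  -- most `2 / p`.
  refine ⟨Solver.iterate (fun x => attempt ((A.prog x).bind fun x => .ret x.findRepeated))
    ⌈1 / p⌉₊, fun x => ?_, fun I D vk sk h => ?_⟩
  · have h := Solver.cost_iterate_le (c := T + 3 * M.costTest)
      (P := fun x => attempt ((A.prog x).bind fun x => .ret x.findRepeated)) (fun x => by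
      refine (cost_attempt_le _).trans (Nat.add_le_add_right ?_ _)
      exact (Prog.cost_bind_le _ _ 0 fun _ => le_rfl).trans (Nat.cast_le.mp (hA x))) ⌈1 / p⌉₊ x
    -- One verification contains two register tests, so two of them pay for the three tests of a
    -- triple. With the rounding this yields the constant `4`.
    have h2 : T + 3 * M.costTest ≤ 2 * (T + M.verifyTime) := by
      rw [Model.verifyTime]; omega
    calc _ ≤ ((⌈1 / p⌉₊ * (2 * (T + M.verifyTime)) : ℕ) : ℝ) :=
          Nat.cast_le.mpr (h.trans (Nat.mul_le_mul_left _ h2))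
      _ = ⌈1 / p⌉₊ * (2 * ((T : ℝ) + M.verifyTime)) := by push_cast; ring
      _ ≤ ((1 + 1) / p) * (2 * ((T : ℝ) + M.verifyTime)) :=
          mul_le_mul_of_nonneg_right (ceil_div_le le_rfl hp hp1) (by positivity)
      _ = _ := by ring
  · refine (half_le_one_sub_pow hp1 (m := ⌈1 / p⌉₊) ?_).trans
      (Solver.le_prob_iterate I D
        (P := fun x => attempt ((A.prog x).bind fun x => .ret x.findRepeated)) hp1 (fun q hq =>
        le_expect_attempt I D hq normSq_zeroState (h.trans (A.prob_le I D vk sk))) _)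
    rw [← div_le_iff₀' hp]
    exact Nat.le_ceil _

end MintAttack

/-! ### Product states -/

section ProdState

variable {N : ℕ} {R Q : Type} [Fintype R]

open Classical in
/-- The amplitude of the state of the qubits in which all of them are zero. -/
def qubitsZero (y : Q → Bool) : ℂ := if ∀ q, y q = false then 1 else 0

/-- The product state with the vector `f r` in the register `r`, all qubits being zero. -/
def prodState (Q : Type) (f : R → Fin N → ℂ) : QState N R Q :=
  fun x => (∏ r, f r (x.1 r)) * qubitsZero x.2

variable [DecidableEq R]

theorem prodState_update (f : R → Fin N → ℂ) (r : R) (w : Fin N → ℂ) (x : Config N R Q) :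
    prodState Q (Function.update f r w) x = w (x.1 r) *
      ((∏ r' ∈ Finset.univ.erase r, f r' (x.1 r')) * qubitsZero x.2) := by
  rw [prodState, ← Finset.mul_prod_erase _ _ (Finset.mem_univ r), Function.update_self, mul_assoc]
  refine congrArg _ (congrArg₂ _ (Finset.prod_congr rfl fun r' hr' => ?_) rfl)
  rw [Function.update_of_ne (Finset.ne_of_mem_erase hr')]

theorem prodState_apply_update (f : R → Fin N → ℂ) (r : R) (a : Fin N) (x : Config N R Q) :
    prodState Q f (Function.update x.1 r a, x.2) = f r a *
      ((∏ r' ∈ Finset.univ.erase r, f r' (x.1 r')) * qubitsZero x.2) := by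
  rw [prodState, ← Finset.mul_prod_erase _ _ (Finset.mem_univ r)]
  dsimp only
  rw [Function.update_self, mul_assoc]
  refine congrArg _ (congrArg₂ _ (Finset.prod_congr rfl fun r' hr' => ?_) rfl)
  rw [Function.update_of_ne (Finset.ne_of_mem_erase hr')]

theorem onReg_prodState (r : R) (A : Matrix (Fin N) (Fin N) ℂ) (f : R → Fin N → ℂ) :
    onReg r A (prodState Q f) = prodState Q (Function.update f r (A.mulVec (f r))) := by
  funext x
  simp only [onReg_apply, prodState_update, prodState_apply_update, Matrix.mulVec, dotProduct,
    Finset.sum_mul, mul_assoc]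

theorem onReg_prodState_of_mulVec {r : R} {A : Matrix (Fin N) (Fin N) ℂ} {f : R → Fin N → ℂ}
    {c : ℂ} (h : A.mulVec (f r) = c • f r) :
    onReg r A (prodState Q f) = c • prodState Q f := by
  rw [onReg_prodState, h]
  conv_rhs => rw [← Function.update_eq_self r f]
  funext x
  rw [Pi.smul_apply, prodState_update, prodState_update, Pi.smul_apply, smul_eq_mul, smul_eq_mul,
    mul_assoc]

omit [DecidableEq R] in
theorem zeroState_eq_prodState [NeZero N] :
    zeroState N R Q = prodState Q (fun _ => Pi.single 0 1) := by
  funext x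
  simp only [zeroState, prodState, qubitsZero, Pi.single_apply, Finset.prod_ite_zero, Finset.prod_const_one,
    Finset.mem_univ, true_imp_iff]
  split_ifs <;> simp_all

omit [DecidableEq R] in
theorem tensor_prodState {R' : Type} [Fintype R'] (f : R ⊕ R' → Fin N → ℂ) :
    tensor (prodState Q (f ∘ Sum.inl)) (prodState Empty (f ∘ Sum.inr)) =
      prodState (Q ⊕ Empty) f := by
  funext x
  have hQ : qubitsZero x.2 = qubitsZero (x.2 ∘ Sum.inl) := by
    unfold qubitsZero
    congr 1
    rw [Sum.forall]
    exact propext (and_iff_left fun a => a.elim)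
  have hE : qubitsZero (x.2 ∘ Sum.inr) = 1 := if_pos fun a => a.elim
  rw [tensor, prodState, prodState, prodState, hQ, hE, mul_one, Fintype.prod_sum_type,
    mul_right_comm]
  rfl

theorem normSq_prodState [Fintype Q] [DecidableEq Q] {f : R → Fin N → ℂ}
    (hf : ∀ r, ∑ a, ‖f r a‖ ^ 2 = 1) : normSq (prodState Q f) = 1 := by
  have h : ∀ (x : R → Fin N) (y : Q → Bool), ‖prodState Q f (x, y)‖ ^ 2 =
      (∏ r, ‖f r (x r)‖ ^ 2) * if y = fun _ => false then 1 else 0 := fun x y => by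
    rw [prodState, norm_mul, mul_pow, norm_prod, Finset.prod_pow]
    refine congrArg _ ?_
    rw [qubitsZero]
    by_cases hy : ∀ q, y q = false
    · rw [if_pos hy, if_pos (funext hy)]; simp
    · rw [if_neg hy, if_neg fun h => hy fun q => by rw [h]]; simp
  simp only [normSq, Fintype.sum_prod_type, h, ← Finset.mul_sum, Finset.sum_ite_eq',
    Finset.mem_univ, if_true, mul_one]
  rw [← Fintype.piFinset_univ, ← Finset.prod_univ_sum (fun _ => Finset.univ) fun r a => ‖f r a‖ ^ 2]
  exact Finset.prod_eq_one fun r _ => hf r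

end ProdState

/-! ### Minting -/

section Mint

variable {M : Model} {Ask R Q α : Type} (I : Instance M) (D : SigScheme M)
  (orc : Ask → PMF M.Sig)

theorem Instance.estOp_mulVec_basis (v : M.Ser) (k : Fin M.N) :
    (I.estOp v).mulVec (fun x => I.basis k x) = I.amp v k • fun x => I.basis k x := by
  simp only [Instance.estOp, Matrix.sum_mulVec, Matrix.smul_mulVec, I.proj_mulVec_basis, smul_ite,
    smul_zero, Finset.sum_ite_eq', Finset.mem_univ, if_true]

theorem Instance.nearProj_mulVec_basis {v : M.Ser} {k : Fin M.N}
    (h : ‖I.val v - I.eig k‖ < I.ε / 2) :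
    (I.nearProj v).mulVec (fun x => I.basis k x) = (1 : ℂ) • fun x => I.basis k x := by
  rw [I.nearProj_eq_proj h, I.proj_mulVec_basis, if_pos rfl, one_smul]

theorem Instance.sum_norm_sq_basis (k : Fin M.N) : ∑ a, ‖I.basis k a‖ ^ 2 = 1 := by
  have h := I.basis.orthonormal.1 k
  rw [EuclideanSpace.norm_eq, Real.sqrt_eq_one] at h
  exact h

variable [Fintype R] [DecidableEq R]

/-- The vectors in the registers after `ψ_k` has been put into the registers `r` and `r'`. -/
def withNote (r r' : R) (k : Fin M.N) (f : R → Fin M.N → ℂ) : R → Fin M.N → ℂ :=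
  Function.update (Function.update f r fun x => I.basis k x) r' fun x => I.basis k x

/-- The discarded registers hold zeros, so the outcome of discarding is certain. The entangled state
has the same form in any real orthonormal basis, here the eigenbasis. -/
theorem bell_prodState {r r' : R} (h : r ≠ r') {f : R → Fin M.N → ℂ} (hr : f r = Pi.single 0 1)
    (hr' : f r' = Pi.single 0 1) (a : Fin M.N × Fin M.N) :
    applyLocal ![r, r'] (Empty.elim : Empty → Q) (bellMat M.N a) (prodState Q f) =
      if a = 0 then ((1 / Real.sqrt M.N : ℝ) : ℂ) • ∑ k, prodState Q (withNote I r r' k f)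
        else 0 := by
  have hE : ∀ x : Config M.N R Q, Function.extend ![r, r'] ![a.1, a.2] x.1 =
      Function.update (Function.update x.1 r a.1) r' a.2 := fun x => by
    funext s
    by_cases hs : ∃ i, ![r, r'] i = s
    · obtain ⟨i, rfl⟩ := hs
      rw [(injective_pair h).extend_apply]
      fin_cases i
      · exact ((Function.update_of_ne h a.2 _).trans (Function.update_self r a.1 x.1)).symm
      · exact (Function.update_self r' a.2 (Function.update x.1 r a.1)).symm
    · have h0 : s ≠ r := fun h' => hs ⟨0, h'.symm⟩
      have h1 : s ≠ r' := fun h' => hs ⟨1, h'.symm⟩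
      rw [Function.extend_apply' _ _ _ hs, Function.update_of_ne h1, Function.update_of_ne h0]
  have hval : ∀ (g : R → Fin M.N → ℂ) (x : Config M.N R Q), prodState Q g x =
      g r (x.1 r) * g r' (x.1 r') * ((∏ s ∈ (Finset.univ.erase r).erase r', g s (x.1 s)) * qubitsZero x.2) := fun g x => by
    rw [prodState, ← Finset.mul_prod_erase _ _ (Finset.mem_univ r),
      ← Finset.mul_prod_erase _ _ (Finset.mem_erase.mpr ⟨h.symm, Finset.mem_univ r'⟩)]
    rw [mul_assoc, mul_assoc, mul_assoc]
  funext x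
  have h1 : applyLocal ![r, r'] (Empty.elim : Empty → Q) (bellMat M.N a) (prodState Q f) x =
      bellMat M.N a (x.1 ∘ ![r, r'], x.2 ∘ Empty.elim) (![a.1, a.2], Empty.elim) *
        prodState Q f (Function.update (Function.update x.1 r a.1) r' a.2, x.2) := by
    rw [applyLocal, Finset.sum_eq_single (![a.1, a.2], Empty.elim)]
    · rw [hE, extend_emptyElim]
    · intro y _ hy
      have : bellMat M.N a (x.1 ∘ ![r, r'], x.2 ∘ Empty.elim) y = 0 := by
        refine if_neg fun h' => hy (Prod.ext (funext fun i => ?_) (Subsingleton.elim _ _))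
        fin_cases i
        exacts [h'.2.1, h'.2.2]
      rw [this, zero_mul]
    · exact fun h' => absurd (Finset.mem_univ _) h'
  have h2 : bellMat M.N a (x.1 ∘ ![r, r'], x.2 ∘ Empty.elim) (![a.1, a.2], Empty.elim) =
      if x.1 r = x.1 r' then ((1 / Real.sqrt M.N : ℝ) : ℂ) else 0 :=
    if_congr ⟨fun h' => h'.1, fun h' => ⟨h', rfl, rfl⟩⟩ rfl rfl
  rw [h1, h2, hval f]
  have h3 : ∀ k, prodState Q (withNote I r r' k f) x = I.basis k (x.1 r) * I.basis k (x.1 r') *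
      ((∏ s ∈ (Finset.univ.erase r).erase r', f s (x.1 s)) * qubitsZero x.2) := fun k => by
    rw [hval, withNote, Function.update_self, Function.update_of_ne h, Function.update_self]
    refine congrArg _ (congrArg₂ _ (Finset.prod_congr rfl fun s hs => ?_) rfl)
    rw [Function.update_of_ne (Finset.ne_of_mem_erase hs),
      Function.update_of_ne (Finset.ne_of_mem_erase (Finset.mem_of_mem_erase hs))]
  have h4 : ∏ s ∈ (Finset.univ.erase r).erase r',
      f s (Function.update (Function.update x.1 r a.1) r' a.2 s) =
      ∏ s ∈ (Finset.univ.erase r).erase r', f s (x.1 s) :=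
    Finset.prod_congr rfl fun s hs => by
      rw [Function.update_of_ne (Finset.ne_of_mem_erase hs),
        Function.update_of_ne (Finset.ne_of_mem_erase (Finset.mem_of_mem_erase hs))]
  simp only [h4, hr, hr', Function.update_self, Function.update_of_ne h, Pi.single_apply]
  by_cases ha : a = 0
  · subst ha
    rw [if_pos rfl, Pi.smul_apply, Finset.sum_apply]
    simp only [h3, ← Finset.sum_mul, I.sum_basis_apply_mul]
    split_ifs <;> simp_all
  · rw [if_neg ha]
    have : ¬ (a.1 = 0 ∧ a.2 = 0) := fun h' => ha (Prod.ext h'.1 h'.2)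
    by_cases ha1 : a.1 = 0
    · have ha2 : a.2 ≠ 0 := fun h' => this ⟨ha1, h'⟩
      simp [ha2]
    · simp [ha1]

/-- A value of the branches of a program that scales like the squared norm. -/
def IsQuadratic {M : Model} {Ask R Q α : Type} (F : List Ask → α → QState M.N R Q → ℝ) : Prop :=
  ∀ l a (c : ℂ) φ, F l a (c • φ) = ‖c‖ ^ 2 * F l a φ

omit [Fintype R] [DecidableEq R] in
theorem Prog.isQuadratic_expect {β : Type} {F : List Ask → β → QState M.N R Q → ℝ}
    (hF : IsQuadratic F) (P : α → Prog M Ask R Q β) :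
    IsQuadratic fun l a φ => (P a).expect I D orc F l φ :=
  fun l a c φ => (P a).expect_smul I D orc hF l c φ

omit [Fintype R] [DecidableEq R] in
theorem IsQuadratic.zero {F : List Ask → α → QState M.N R Q → ℝ} (hF : IsQuadratic F)
    (l : List Ask) (a : α) : F l a 0 = 0 := by
  have := hF l a 0 0
  rwa [zero_smul, norm_zero, zero_pow two_ne_zero, zero_mul] at this

omit [Fintype R] [DecidableEq R] in
-- With at most one nonzero coefficient there is no interference, so the superposition may be
-- replaced by a probabilistic mixture.
theorem IsQuadratic.sum_smul {ι : Type} [Fintype ι] {F : List Ask → α → QState M.N R Q → ℝ}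
    (hF : IsQuadratic F) (l : List Ask) (a : α) (c : ι → ℂ) (φ : ι → QState M.N R Q)
    (hc : ∀ i j, c i ≠ 0 → c j ≠ 0 → i = j) :
    F l a (∑ i, c i • φ i) = ∑ i, ‖c i‖ ^ 2 * F l a (φ i) := by
  by_cases h : ∃ i, c i ≠ 0
  · obtain ⟨i, hi⟩ := h
    have h0 : ∀ j, j ≠ i → c j = 0 := fun j hj => by
      by_contra hcj
      exact hj (hc j i hcj hi)
    rw [Fintype.sum_eq_single i fun j hj => by rw [h0 j hj, zero_smul],
      Fintype.sum_eq_single i fun j hj => by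
        rw [h0 j hj, norm_zero, zero_pow two_ne_zero, zero_mul], hF]
  · have h0 : ∀ j, c j = 0 := fun j => by
      by_contra hcj
      exact h ⟨j, hcj⟩
    simp only [h0, zero_smul, Finset.sum_const_zero, norm_zero, ne_eq, OfNat.ofNat_ne_zero,
      not_false_eq_true, zero_pow, zero_mul, hF.zero]

/-- The program `sg m` produces a signature of `m` under the key `sk` by means of the oracle
queries `qs m`. -/
def Signs (sk : M.SK) (sg : M.Ser → Prog M Ask R Q M.Sig) (qs : M.Ser → List Ask) : Prop :=
  ∀ (F : List Ask → M.Sig → QState M.N R Q → ℝ), IsQuadratic F → ∀ m l φ,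
    (sg m).expect I D orc F l φ = ∑ σ, (D.sign sk m σ).toReal * F (l ++ qs m) σ φ

omit [Fintype R] [DecidableEq R] in
theorem sqrt_smul_quadratic {F : List Ask → α → QState M.N R Q → ℝ} (hF : IsQuadratic F)
    {A : Type} (μ : PMF A) (b : A) (l : List Ask) (a : α) (φ : QState M.N R Q) :
    F l a (((Real.sqrt (μ b).toReal : ℝ) : ℂ) • φ) = (μ b).toReal * F l a φ := by
  rw [hF, Complex.norm_real, Real.norm_eq_abs, sq_abs, Real.sq_sqrt ENNReal.toReal_nonneg]

omit [Fintype R] [DecidableEq R] in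
theorem signs_ask (sk : M.SK) :
    Signs (R := R) (Q := Q) I D (D.sign sk) sk (fun m => .step (.ask m) fun (σ : M.Sig) => .ret σ)
      fun m => [m] :=
  fun _ hF m _ _ => Finset.sum_congr rfl fun _ _ => sqrt_smul_quadratic hF (D.sign sk m) _ _ _ _

omit [Fintype R] [DecidableEq R] in
theorem signs_sign (sk : M.SK) :
    Signs (R := R) (Q := Q) I D orc sk (fun m => .step (.sign sk m) fun (σ : M.Sig) => .ret σ)
      fun _ => [] :=
  fun _ hF m _ _ => Finset.sum_congr rfl fun _ _ => sqrt_smul_quadratic hF (D.sign sk m) _ _ _ _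

/-- The minting algorithm, with `sg` in the place of the signing algorithm. -/
def mintWith (sg : M.Ser → Prog M Ask R Q M.Sig) (r r' : R) (h : r ≠ r') :
    Prog M Ask R Q (M.Ser × M.Sig) :=
  .step (.bell r r' h) fun _ => .step (.phaseEst r) fun (v : M.Ser) =>
    (sg v).bind fun σ => .ret (v, σ)

omit [Fintype R] [DecidableEq R] in
theorem cost_mintWith_le {sg : M.Ser → Prog M Ask R Q M.Sig} (hsg : ∀ m, (sg m).cost ≤ M.costSign)
    (r r' : R) (h : r ≠ r') : (mintWith sg r r' h).cost ≤ M.mintTime :=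
  Prog.cost_step_le _ _ _ fun _ => Prog.cost_step_le _ _ _ fun _ =>
    (Prog.cost_bind_le _ _ 0 fun _ => le_rfl).trans (hsg _)

omit [Fintype R] [DecidableEq R] in
theorem asks_mintWith_le {sg : M.Ser → Prog M Ask R Q M.Sig} (hsg : ∀ m, (sg m).asks ≤ 1)
    (r r' : R) (h : r ≠ r') : (mintWith sg r r' h).asks ≤ 1 :=
  (Prog.asks_step_le (.bell r r' h) _ 1 fun _ => (Prog.asks_step_le (.phaseEst r) _ 1 fun _ =>
    (Prog.asks_bind_le _ _ 0 fun _ => le_rfl).trans (hsg _)).trans (Nat.zero_add 1).le).trans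
      (Nat.zero_add 1).le

/-- Minting samples a uniformly random bill: `Φ` is a uniform superposition of the `ψ_k ⊗ ψ_k`, and
the estimate collapses it to one of them without disturbing it. -/
theorem expect_mintWith {sk : M.SK} {sg : M.Ser → Prog M Ask R Q M.Sig} {qs : M.Ser → List Ask}
    (hsg : Signs I D orc sk sg qs) {F : List Ask → M.Ser × M.Sig → QState M.N R Q → ℝ}
    (hF : IsQuadratic F) {r r' : R} (h : r ≠ r') {f : R → Fin M.N → ℂ}
    (hr : f r = Pi.single 0 1) (hr' : f r' = Pi.single 0 1) (l : List Ask) :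
    (mintWith sg r r' h).expect I D orc F l (prodState Q f) =
      ∑ b, billProb I D sk b * F (l ++ qs b.2.1) b.2 (prodState Q (withNote I r r' b.1 f)) := by
  have hsig : IsQuadratic fun (l : List Ask) (v : M.Ser) (φ : QState M.N R Q) =>
      ((sg v).bind fun σ => Prog.ret (v, σ)).expect I D orc F l φ :=
    Prog.isQuadratic_expect I D orc hF _
  have hest : IsQuadratic fun (l : List Ask) (_ : Unit) (φ : QState M.N R Q) =>
      (Prog.step (.phaseEst r) fun (v : M.Ser) =>
        (sg v).bind fun σ => Prog.ret (v, σ)).expect I D orc F l φ :=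
    Prog.isQuadratic_expect I D orc hF _
  have hN : ‖((1 / Real.sqrt M.N : ℝ) : ℂ)‖ ^ 2 = 1 / (M.N : ℝ) := by
    rw [Complex.norm_real, Real.norm_eq_abs, sq_abs, div_pow, one_pow,
      Real.sq_sqrt (Nat.cast_nonneg _)]
  have h1 : ∀ v, onReg r (I.estOp v) (∑ k, prodState Q (withNote I r r' k f)) =
      ∑ k, I.amp v k • prodState Q (withNote I r r' k f) := fun v => by
    rw [onReg, applyLocal_sum]
    refine Finset.sum_congr rfl fun k _ => onReg_prodState_of_mulVec ?_
    rw [withNote, Function.update_of_ne h, Function.update_self]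
    exact I.estOp_mulVec_basis v k
  have h2 : ∀ v k, ((sg v).bind fun σ => Prog.ret (v, σ)).expect I D orc F l
      (prodState Q (withNote I r r' k f)) = ∑ σ, (D.sign sk v σ).toReal *
        F (l ++ qs v) (v, σ) (prodState Q (withNote I r r' k f)) := fun v k => by
    rw [Prog.expect_bind]
    exact hsg _ (fun l σ c φ => hF l (v, σ) c φ) v l _
  calc (mintWith sg r r' h).expect I D orc F l (prodState Q f)
      = ∑ a : Fin M.N × Fin M.N, (Prog.step (.phaseEst r) fun (v : M.Ser) =>
          (sg v).bind fun σ => Prog.ret (v, σ)).expect I D orc F (l ++ [])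
          (applyLocal ![r, r'] (Empty.elim : Empty → Q) (bellMat M.N a) (prodState Q f)) := rfl
    _ = (Prog.step (.phaseEst r) fun (v : M.Ser) =>
          (sg v).bind fun σ => Prog.ret (v, σ)).expect I D orc F l
          (((1 / Real.sqrt M.N : ℝ) : ℂ) • ∑ k, prodState Q (withNote I r r' k f)) := by
        simp only [bell_prodState I h hr hr', List.append_nil]
        -- Branches with a nonzero outcome of discarding carry the zero state and have no weight.
        rw [Fintype.sum_eq_single 0 fun a ha => by rw [if_neg ha]; exact hest.zero _ (), if_pos rfl]
    _ = 1 / (M.N : ℝ) * ∑ v, ((sg v).bind fun σ => Prog.ret (v, σ)).expect I D orc F (l ++ [])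
          (onReg r (I.estOp v) (∑ k, prodState Q (withNote I r r' k f))) := by
        rw [← hN]
        exact hest l () _ _
    _ = 1 / (M.N : ℝ) * ∑ v, ∑ k, ‖I.amp v k‖ ^ 2 * ∑ σ, (D.sign sk v σ).toReal *
          F (l ++ qs v) (v, σ) (prodState Q (withNote I r r' k f)) := by
        simp only [h1, List.append_nil, ← h2]
        refine congrArg _ (Finset.sum_congr rfl fun v _ => hsig.sum_smul l v _ _ fun i j hi hj => ?_)
        -- A given estimate `v` has nonzero amplitude on at most one eigenvector, which is what
        -- excludes interference between different `k`.
        exact I.near_unique (I.near_of_amp_ne_zero hi) (I.near_of_amp_ne_zero hj)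
    _ = _ := by
        rw [Finset.sum_comm]
        simp only [Fintype.sum_prod_type, billProb, Finset.mul_sum, mul_assoc]

/-- All but the first of the places for notes. -/
def succPlaces {m : ℕ} (e : Fin (m + 1) × Fin 2 ↪ R) : Fin m × Fin 2 ↪ R where
  toFun p := e (p.1.succ, p.2)
  inj' p p' h := by
    have := e.injective h
    simp only [Prod.mk.injEq, Fin.succ_inj] at this
    exact Prod.ext this.1 this.2

omit [Fintype R] [DecidableEq R] in
theorem places_ne {m : ℕ} (e : Fin (m + 1) × Fin 2 ↪ R) : e (0, 0) ≠ e (0, 1) :=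
  e.injective.ne (by simp)

/-- Mint `m` bills, with the notes placed into the registers `e`. -/
def mintMany (sg : M.Ser → Prog M Ask R Q M.Sig) :
    {m : ℕ} → (Fin m × Fin 2 ↪ R) → Prog M Ask R Q (Fin m → M.Ser × M.Sig)
  | 0, _ => .ret Fin.elim0
  | _ + 1, e => (mintWith sg (e (0, 0)) (e (0, 1)) (places_ne e)).bind fun b =>
      (mintMany sg (succPlaces e)).bind fun bs => .ret (Fin.cons b bs)

omit [Fintype R] [DecidableEq R] in
theorem cost_mintMany_le {sg : M.Ser → Prog M Ask R Q M.Sig} (hsg : ∀ m, (sg m).cost ≤ M.costSign)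
    {m : ℕ} (e : Fin m × Fin 2 ↪ R) : (mintMany sg e).cost ≤ M.mintTime * m := by
  induction m with
  | zero => exact Nat.zero_le _
  | succ m ih =>
    refine (Prog.cost_bind_le _ _ (M.mintTime * m) fun b =>
      (Prog.cost_bind_le _ _ 0 fun _ => le_rfl).trans (ih _)).trans ?_
    rw [Nat.mul_succ, add_comm]
    exact Nat.add_le_add_left (cost_mintWith_le hsg _ _ _) _

omit [Fintype R] [DecidableEq R] in
theorem asks_mintMany_le {sg : M.Ser → Prog M Ask R Q M.Sig} (hsg : ∀ m, (sg m).asks ≤ 1)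
    {m : ℕ} (e : Fin m × Fin 2 ↪ R) : (mintMany sg e).asks ≤ m := by
  induction m with
  | zero => exact Nat.zero_le _
  | succ m ih =>
    refine (Prog.asks_bind_le _ _ m fun b =>
      (Prog.asks_bind_le _ _ 0 fun _ => le_rfl).trans (ih _)).trans ?_
    rw [add_comm]
    exact Nat.add_le_add_left (asks_mintWith_le hsg _ _ _) _

/-- The vectors in the registers after the notes `ψ_{k i} ⊗ ψ_{k i}` have been put into the
registers `e`. -/
def withNotes : {m : ℕ} → (Fin m × Fin 2 ↪ R) → (Fin m → Fin M.N) → (R → Fin M.N → ℂ) →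
    R → Fin M.N → ℂ
  | 0, _, _, f => f
  | _ + 1, e, k, f => withNotes (succPlaces e) (fun i => k i.succ)
      (withNote I (e (0, 0)) (e (0, 1)) (k 0) f)

omit [Fintype R] in
theorem withNote_of_ne {r r' s : R} (h : s ≠ r) (h' : s ≠ r') (k : Fin M.N)
    (f : R → Fin M.N → ℂ) : withNote I r r' k f s = f s := by
  rw [withNote, Function.update_of_ne h', Function.update_of_ne h]

omit [Fintype R] in
theorem withNotes_of_notMem {m : ℕ} (e : Fin m × Fin 2 ↪ R) (k : Fin m → Fin M.N)
    (f : R → Fin M.N → ℂ) {r : R} (hr : ∀ p, e p ≠ r) : withNotes I e k f r = f r := by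
  induction m generalizing f with
  | zero => rfl
  | succ m ih =>
    rw [withNotes, ih (succPlaces e) (fun i => k i.succ) _ fun p => hr _,
      withNote_of_ne I (hr _).symm (hr _).symm]

omit [Fintype R] in
theorem withNotes_apply {m : ℕ} (e : Fin m × Fin 2 ↪ R) (k : Fin m → Fin M.N)
    (f : R → Fin M.N → ℂ) (i : Fin m) (c : Fin 2) :
    withNotes I e k f (e (i, c)) = fun x => I.basis (k i) x := by
  induction m generalizing f with
  | zero => exact i.elim0
  | succ m ih =>
    rw [withNotes]
    refine Fin.cases ?_ (fun i => ?_) i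
    · rw [withNotes_of_notMem]
      · by_cases hc : c = 1
        · rw [hc, withNote, Function.update_self]
        · have hc0 : c = 0 := by omega
          rw [hc0, withNote, Function.update_of_ne (places_ne e), Function.update_self]
      · exact fun p => e.injective.ne fun h => Fin.succ_ne_zero _ (Prod.ext_iff.mp h).1
    · exact ih (succPlaces e) (fun i => k i.succ) _ i

/-- The oracle queries made for the signatures of given bills. -/
def billQueries (qs : M.Ser → List Ask) {m : ℕ} (x : Fin m → Fin M.N × M.Ser × M.Sig) :
    List Ask :=
  (List.ofFn fun i => qs (x i).2.1).flatten

/-- After each minting step the memory is again a product state, with the remaining places still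
zero. The one-bill computation therefore applies inductively and the bills are independent. -/
theorem expect_mintMany {sk : M.SK} {sg : M.Ser → Prog M Ask R Q M.Sig} {qs : M.Ser → List Ask}
    (hsg : Signs I D orc sk sg qs) {m : ℕ} {F : List Ask → (Fin m → M.Ser × M.Sig) →
      QState M.N R Q → ℝ}
    (hF : IsQuadratic F) (e : Fin m × Fin 2 ↪ R) {f : R → Fin M.N → ℂ}
    (hf : ∀ p, f (e p) = Pi.single 0 1) (l : List Ask) :
    (mintMany sg e).expect I D orc F l (prodState Q f) =
      ∑ x : Fin m → Fin M.N × M.Ser × M.Sig, (∏ i, billProb I D sk (x i)) *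
        F (l ++ billQueries qs x) (fun i => (x i).2)
          (prodState Q (withNotes I e (fun i => (x i).1) f)) := by
  induction m generalizing l f with
  | zero =>
    rw [Fintype.sum_unique, Finset.univ_eq_empty, Finset.prod_empty, one_mul]
    simp only [mintMany, Prog.expect, billQueries, List.ofFn_zero, List.flatten_nil,
      List.append_nil, withNotes]
    congr 1
    exact Subsingleton.elim _ _
  | succ m ih =>
    rw [mintMany, Prog.expect_bind, expect_mintWith I D orc hsg
      (Prog.isQuadratic_expect I D orc hF _) _ (hf _) (hf _), sum_fin_succ_arrow]
    refine Finset.sum_congr rfl fun b _ => ?_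
    rw [Prog.expect_bind, ih (F := fun l bs φ => Prog.expect I D orc F (Prog.ret (Fin.cons b.2 bs)) l φ)
      (fun l bs c φ => hF l _ c φ), Finset.mul_sum]
    · refine Finset.sum_congr rfl fun x _ => ?_
      rw [Fin.prod_univ_succ, mul_assoc]
      simp only [Fin.cons_zero, Fin.cons_succ, Prog.expect, billQueries, List.ofFn_succ,
        List.flatten_cons, List.append_assoc, withNotes]
      congr 3
      funext i
      refine Fin.cases ?_ (fun i => ?_) i <;> simp
    · intro p
      rw [withNote_of_ne, ← hf (p.1.succ, p.2)]
      · rfl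
      all_goals exact e.injective.ne fun h => Fin.succ_ne_zero _ (Prod.ext_iff.mp h).1

end Mint

/-! ### Attacks by others -/

section Extract

variable {M : Model} {n s : ℕ} {R Q : Type}

/-- Both halves of the note `i` of the first part of the memory and the first half of the note `j`
of the second part. -/
def Bills.spareTriple {m : ℕ} (x : Bills M m R) (i : Fin m) (j : Fin s) :
    Fin 3 ↪ R ⊕ Fin s × Fin 2 where
  toFun := ![.inl (x.left i), .inl (x.right i), .inr (j, 0)]
  inj' a b hab := by
    have h : x.left i ≠ x.right i := x.distinct.ne (a₁ := .inl i) (a₂ := .inr i) (by simp)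
    fin_cases a <;> fin_cases b <;> first | rfl | simp [h, h.symm] at hab

open Classical in
/-- Given the signed serial numbers `b` and `b'` of minted bills, where the notes of the latter have
been kept, and further alleged bills `x`, find either a new signature among the latter, or three
registers that should contain the same eigenvector together with a serial number for it. -/
def Bills.extract (x : Bills M (n + 1) R) (b : Fin n → M.Ser × M.Sig) (b' : Fin s → M.Ser × M.Sig) :
    (M.Ser × M.Sig) × Option (Fin 3 ↪ R ⊕ Fin s × Fin 2) :=
  if h : ∃ i, (∀ j, x.serial i ≠ (b j).1) ∧ ∀ j, x.serial i ≠ (b' j).1 then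
    ((x.serial h.choose, x.sig h.choose), none)
  else if h : ∃ p : Fin (n + 1) × Fin (n + 1), p.1 ≠ p.2 ∧ x.serial p.1 = x.serial p.2 then
    ((x.serial h.choose.1, x.sig h.choose.1), some ((x.triple h.choose_spec.1).trans .inl))
  else if h : ∃ p : Fin (n + 1) × Fin s, x.serial p.1 = (b' p.2).1 then
    ((x.serial h.choose.1, x.sig h.choose.1), some (x.spareTriple h.choose.1 h.choose.2))
  else ((x.serial 0, x.sig 0), none)

/-- If no kept serial number occurred, all `n + 1` would be among the `n` that were handed over,
forcing a repetition. Hence the final default in `Bills.extract` is never reached. -/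
theorem Bills.exists_spare (x : Bills M (n + 1) R) (b : Fin n → M.Ser × M.Sig)
    (b' : Fin s → M.Ser × M.Sig)
    (h : ¬ ∃ i, (∀ j, x.serial i ≠ (b j).1) ∧ ∀ j, x.serial i ≠ (b' j).1)
    (h' : ¬ ∃ p : Fin (n + 1) × Fin (n + 1), p.1 ≠ p.2 ∧ x.serial p.1 = x.serial p.2) :
    ∃ p : Fin (n + 1) × Fin s, x.serial p.1 = (b' p.2).1 := by
  by_contra hne
  have hb : ∀ i, ∃ j, x.serial i = (b j).1 := fun i => by
    by_contra hi
    exact h ⟨i, fun j hj => hi ⟨j, hj⟩, fun j hj => hne ⟨(i, j), hj⟩⟩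
  choose g hg using hb
  obtain ⟨i, j, hij, hgij⟩ := Fintype.exists_ne_map_eq_of_card_lt g (by simp)
  exact h' ⟨(i, j), hij, by rw [hg, hg, hgij]⟩

variable (I : Instance M) (D : SigScheme M)

/-- The notes kept by the minting party. -/
def spareState (k : Fin s → Fin M.N) : QState M.N (Fin s × Fin 2) Empty :=
  prodState Empty fun p x => I.basis (k p.1) x

theorem normSq_spareState (k : Fin s → Fin M.N) : normSq (spareState I k) = 1 :=
  normSq_prodState fun p => I.sum_norm_sq_basis (k p.1)

theorem tripleTest_tensor_left {R' Q' : Type} (v : M.Ser) (e : Fin 3 ↪ R) (φ : QState M.N R Q)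
    (χ : QState M.N R' Q') :
    tripleTest I v (e.trans .inl) (tensor φ χ) = tensor (tripleTest I v e φ) χ := by
  rw [tripleTest, tripleTest, ← onReg_tensor_left, ← onReg_tensor_left, ← onReg_tensor_left]
  rfl

variable [Fintype R] [DecidableEq R] [Fintype Q] [DecidableEq Q]

/-- The kept half holds exactly the eigenvector selected by the serial number, so its test succeeds
with certainty. The other two tests belong to the verification of bill `i`. -/
theorem Bills.passWeight_le_spareTriple (vk : M.VK) {m : ℕ} (x : Bills M m R) (i : Fin m)
    (j : Fin s) (k : Fin s → Fin M.N) (h : ‖I.val (x.serial i) - I.eig (k j)‖ < I.ε / 2)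
    (φ : QState M.N R Q) :
    x.passWeight I D vk φ ≤
      normSq (tripleTest I (x.serial i) (x.spareTriple i j) (tensor φ (spareState I k))) := by
  have h1 : onReg (j, 0) (I.nearProj (x.serial i)) (spareState I k) = spareState I k := by
    refine (onReg_prodState_of_mulVec (c := 1) ?_).trans (one_smul _ _)
    exact I.nearProj_mulVec_basis h
  have h2 : tripleTest I (x.serial i) (x.spareTriple i j) (tensor φ (spareState I k)) =
      tensor (x.test I (.inl i) (x.test I (.inr i) φ)) (spareState I k) := by
    rw [Bills.test, Bills.test, ← onReg_tensor_left, ← onReg_tensor_left]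
    conv_rhs => rw [← h1, ← onReg_tensor_right]
    rfl
  rw [h2, normSq_tensor, normSq_spareState, mul_one, ← x.passWeight_test I D vk (.inr i),
    ← x.passWeight_test I D vk (.inl i)]
  exact x.passWeight_le I D vk _

/-- The hypothesis on `l` says that only minted serial numbers were queried, so a valid signature on
any other one is new. A repeated serial number and one of a kept note both yield a triple. -/
theorem Bills.passWeight_le_extract (vk : M.VK) (x : Bills M (n + 1) R)
    (b : Fin n → M.Ser × M.Sig) (b' : Fin s → M.Ser × M.Sig) (k : Fin s → Fin M.N)
    (hk : ∀ j, ‖I.val (b' j).1 - I.eig (k j)‖ < I.ε / 2) (l : List M.Ser)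
    (hl : ∀ m ∈ l, (∃ j, m = (b j).1) ∨ ∃ j, m = (b' j).1) (φ : QState M.N R Q) :
    x.passWeight I D vk φ ≤
      (x.extract b b').2.elim
        (newSigWeight D vk l (x.extract b b').1 (tensor φ (spareState I k)))
        fun e => normSq (tripleTest I (x.extract b b').1.1 e (tensor φ (spareState I k))) := by
  rw [Bills.extract]
  split_ifs with h1 h2 h3
  · rw [Option.elim_none, newSigWeight]
    by_cases hv : D.verify vk (x.serial h1.choose) (x.sig h1.choose) = true
    · have hnew : x.serial h1.choose ∉ l := fun hm => by
        rcases hl _ hm with ⟨j, hj⟩ | ⟨j, hj⟩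
        exacts [h1.choose_spec.1 j hj, h1.choose_spec.2 j hj]
      rw [if_pos ⟨hv, hnew⟩, normSq_tensor, normSq_spareState, mul_one]
      exact x.passWeight_le I D vk φ
    · rw [x.passWeight_eq_zero I D hv, if_neg fun h => hv h.1]
  · rw [Option.elim_some, tripleTest_tensor_left, normSq_tensor, normSq_spareState, mul_one]
    exact x.passWeight_le_tripleTest I D vk h2.choose_spec.1 h2.choose_spec.2 φ
  · refine x.passWeight_le_spareTriple I D vk h3.choose.1 h3.choose.2 k ?_ φ
    rw [h3.choose_spec]
    exact hk _
  · exact absurd (x.exists_spare b b' h1 h2) h3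

end Extract

/-! ### Simulating the attacker with minted bills -/

section Simulation

variable {M : Model} {n s : ℕ} (A : Attack M n s)

/-- Mint `n + s` bills with signatures obtained by `sg`, give the first `n` of them and the signed
serial numbers of the others to the attacker, and extract a forgery or a triple from the bills
that the attacker returns. -/
def Attack.simulate {Ask : Type}
    (sg : M.Ser → Prog M Ask (A.R ⊕ Fin s × Fin 2) (A.Q ⊕ Empty) M.Sig) (vk : M.VK) :
    Prog M Ask (A.R ⊕ Fin s × Fin 2) (A.Q ⊕ Empty)
      ((M.Ser × M.Sig) × Option (Fin 3 ↪ A.R ⊕ Fin s × Fin 2)) :=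
  (mintMany sg (A.inReg.trans .inl)).bind fun b =>
    (mintMany sg (.inr : Fin s × Fin 2 ↪ A.R ⊕ Fin s × Fin 2)).bind fun b' =>
      ((A.prog (vk, b, b')).relabel Empty.elim .inl .inl).bind fun x => .ret (x.extract b b')

theorem Attack.cost_simulate_le {Ask : Type} {T : ℕ} (hA : A.RunsIn T)
    {sg : M.Ser → Prog M Ask (A.R ⊕ Fin s × Fin 2) (A.Q ⊕ Empty) M.Sig}
    (hsg : ∀ m, (sg m).cost ≤ M.costSign) (vk : M.VK) :
    (A.simulate sg vk).cost ≤ T + M.mintTime * (n + s) := by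
  refine (Prog.cost_bind_le _ _ (M.mintTime * s + T) fun b =>
    (Prog.cost_bind_le _ _ T fun b' => (Prog.cost_bind_le _ _ 0 fun _ => le_rfl).trans
      ((Prog.cost_relabel_le _ _ _ _).trans (Nat.cast_le.mp (hA _)))).trans
      (Nat.add_le_add_right (cost_mintMany_le hsg _) _)).trans ?_
  rw [mul_add]
  have := cost_mintMany_le hsg (A.inReg.trans (.inl : A.R ↪ A.R ⊕ Fin s × Fin 2))
  omega

theorem Attack.asks_simulate_le {Ask : Type}
    {sg : M.Ser → Prog M Ask (A.R ⊕ Fin s × Fin 2) (A.Q ⊕ Empty) M.Sig}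
    (hsg : ∀ m, (sg m).asks ≤ 1) (vk : M.VK) :
    (A.simulate sg vk).asks ≤ n + s := by
  refine (Prog.asks_bind_le _ _ s fun b =>
    (Prog.asks_bind_le _ _ 0 fun b' => (Prog.asks_bind_le _ _ 0 fun _ => le_rfl).trans
      ((Prog.asks_relabel_le _ _ _ _).trans (Prog.asks_eq_zero _).le)).trans
      (asks_mintMany_le hsg _)).trans (Nat.add_le_add_right (asks_mintMany_le hsg _) _)

variable (I : Instance M) (D : SigScheme M)

/-- Used to recognize the attacker's part of the memory after minting as the initial state that the
attack expects. -/
theorem init_eq_prodState {Ask In : Type} {Out : Type → Type} (A : Alg M Ask In n Out)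
    (k : Fin n → Fin M.N) {f : A.R → Fin M.N → ℂ}
    (hf : ∀ i c, f (A.inReg (i, c)) = fun x => I.basis (k i) x)
    (hf' : ∀ r, r ∉ Set.range A.inReg → f r = Pi.single 0 1) :
    A.init I k = prodState A.Q f := by
  classical
  funext x
  have h1 : ∏ r, f r (x.1 r) = (∏ i, ∏ h, I.basis (k i) (x.1 (A.inReg (i, h)))) *
      if ∀ r, r ∉ Set.range A.inReg → x.1 r = 0 then 1 else 0 := by
    rw [← Finset.prod_mul_prod_compl (Finset.univ.map A.inReg), Finset.prod_map,
      Fintype.prod_prod_type]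
    simp only [hf]
    congr 1
    rw [Finset.prod_congr rfl (g := fun r => if x.1 r = 0 then (1 : ℂ) else 0) fun r hr => by
      rw [hf' r fun ⟨p, hp⟩ => Finset.mem_compl.mp hr
        (Finset.mem_map.mpr ⟨p, Finset.mem_univ p, hp⟩), Pi.single_apply],
      Finset.prod_ite_zero, Finset.prod_const_one]
    have hr : (∀ r ∈ (Finset.univ.map A.inReg)ᶜ, x.1 r = 0) ↔
        ∀ r, r ∉ Set.range A.inReg → x.1 r = 0 := by
      simp only [Finset.mem_compl, Finset.mem_map, Finset.mem_univ, true_and, Set.mem_range]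
    by_cases hx : ∀ r, r ∉ Set.range A.inReg → x.1 r = 0
    · rw [if_pos hx, if_pos (hr.mpr hx)]
    · rw [if_neg hx, if_neg (mt hr.mp hx)]
  rw [Alg.init, prodState, h1, qubitsZero]
  split_ifs <;> simp_all

/-- The attacker sees exactly the distribution in `Attack.prob`, in tensor product with the kept
notes. The signing method enters only through the query log, so weights that ignore the log agree
for oracle and key. -/
theorem Attack.expect_simulate {Ask : Type} {orc : Ask → PMF M.Sig} {sk : M.SK}
    {sg : M.Ser → Prog M Ask (A.R ⊕ Fin s × Fin 2) (A.Q ⊕ Empty) M.Sig} {qs : M.Ser → List Ask}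
    (hsg : Signs I D orc sk sg qs)
    {F : List Ask → (M.Ser × M.Sig) × Option (Fin 3 ↪ A.R ⊕ Fin s × Fin 2) →
      QState M.N (A.R ⊕ Fin s × Fin 2) (A.Q ⊕ Empty) → ℝ} (hF : IsQuadratic F) (vk : M.VK) :
    (A.simulate sg vk).expect I D orc F [] (zeroState M.N _ _) =
      ∑ x : Fin n → Fin M.N × M.Ser × M.Sig, ∑ y : Fin s → Fin M.N × M.Ser × M.Sig,
        (∏ i, billProb I D sk (x i)) * (∏ i, billProb I D sk (y i)) *
          (A.prog (vk, fun i => (x i).2, fun i => (y i).2)).expect I D (fun a => a.elim)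
            (fun _ z φ => F (billQueries qs x ++ billQueries qs y)
              (z.extract (fun i => (x i).2) fun i => (y i).2)
              (tensor φ (spareState I fun i => (y i).1))) [] (A.init I fun i => (x i).1) := by
  rw [Attack.simulate, Prog.expect_bind, zeroState_eq_prodState,
    expect_mintMany I D orc hsg (Prog.isQuadratic_expect I D orc hF _) _ fun _ => rfl]
  refine Finset.sum_congr rfl fun x _ => ?_
  rw [Prog.expect_bind, expect_mintMany I D orc hsg (Prog.isQuadratic_expect I D orc hF _),
    Finset.mul_sum]
  · refine Finset.sum_congr rfl fun y _ => ?_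
    rw [← mul_assoc]
    refine congrArg _ ?_
    rw [Prog.expect_bind, ← tensor_prodState, ← init_eq_prodState I A fun i => (x i).1]
    · have hspare : (withNotes I .inr (fun i => (y i).1)
          (withNotes I (A.inReg.trans .inl) (fun i => (x i).1) fun _ => Pi.single 0 1)) ∘
            (Sum.inr : Fin s × Fin 2 → A.R ⊕ Fin s × Fin 2) =
          fun p x => I.basis (y p.1).1 x := by
        funext p
        exact withNotes_apply I .inr _ _ p.1 p.2
      rw [hspare]
      have hrel := Prog.expect_relabel_inl I D (orc := fun a : Empty => a.elim) (orc' := orc)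
        (h := Empty.elim) (fun a => a.elim) (fun l z φ => Prog.expect I D orc F
          (Prog.ret (z.extract (fun i => (x i).2) fun i => (y i).2)) l φ)
        (A.prog (vk, fun i => (x i).2, fun i => (y i).2))
        ([] ++ billQueries qs x ++ billQueries qs y) [] (A.init I fun i => (x i).1)
        (spareState I fun i => (y i).1)
      rw [List.map_nil, List.append_nil] at hrel
      refine hrel.trans ?_
      congr 1
      funext l z φ
      rw [list_eq_nil_of_isEmpty l, List.map_nil, List.append_nil, List.nil_append]
      rfl
    · intro i c
      refine (withNotes_of_notMem I _ _ _ fun p => Sum.inr_ne_inl).trans ?_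
      exact withNotes_apply I (A.inReg.trans .inl) _ _ i c
    · intro r hr
      refine (withNotes_of_notMem I _ _ _ fun p => Sum.inr_ne_inl).trans ?_
      exact withNotes_of_notMem I _ _ _ fun p hp => hr ⟨p, Sum.inl_injective hp⟩
  · exact fun p => withNotes_of_notMem I _ _ _ fun p' => Sum.inl_ne_inr

theorem billProb_nonneg (sk : M.SK) (b : Fin M.N × M.Ser × M.Sig) : 0 ≤ billProb I D sk b := by
  unfold billProb
  positivity

/-- The weight with which a result contains a new signature. -/
def forgeryWeight {R Q : Type} [Fintype R] [DecidableEq R] [Fintype Q] [DecidableEq Q]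
    (vk : M.VK) (l : List M.Ser) (c : (M.Ser × M.Sig) × Option (Fin 3 ↪ R))
    (φ : QState M.N R Q) : ℝ :=
  c.2.elim (newSigWeight D vk l c.1 φ) fun _ => 0

/-- The weight with which a result contains three registers that pass the test against its serial
number. -/
def testedWeight {R Q : Type} [Fintype R] [DecidableEq R] [Fintype Q] [DecidableEq Q]
    (c : (M.Ser × M.Sig) × Option (Fin 3 ↪ R)) (φ : QState M.N R Q) : ℝ :=
  c.2.elim 0 fun e => normSq (tripleTest I c.1.1 e φ)

section Weights

variable {Ask R Q : Type} [Fintype R] [DecidableEq R] [Fintype Q] [DecidableEq Q]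

theorem newSigWeight_nonneg (vk : M.VK) (l : List M.Ser) (c : M.Ser × M.Sig)
    (φ : QState M.N R Q) : 0 ≤ newSigWeight D vk l c φ := by
  unfold newSigWeight
  split_ifs
  exacts [normSq_nonneg φ, le_rfl]

theorem isQuadratic_forgeryWeight (vk : M.VK) :
    IsQuadratic (R := R) (Q := Q) (forgeryWeight D vk) := by
  rintro l ⟨c, o⟩ a φ
  cases o with
  | none =>
    simp only [forgeryWeight, Option.elim_none, newSigWeight, normSq_smul, mul_ite, mul_zero]
  | some e => exact (mul_zero _).symm

theorem isQuadratic_testedWeight :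
    IsQuadratic (Ask := Ask) (R := R) (Q := Q) fun _ => testedWeight I := by
  rintro l ⟨c, o⟩ a φ
  cases o with
  | none => exact (mul_zero _).symm
  | some e => simp only [testedWeight, Option.elim_some, tripleTest, onReg_smul, normSq_smul]

end Weights

/-- The real and the simulated attack have the same branches, and on each of them extraction
accounts for the whole acceptance weight, either as a forgery or as a tested triple. -/
theorem Attack.prob_le_simulate (vk : M.VK) (sk : M.SK) :
    A.prob I D vk sk ≤
      (A.simulate (fun m => .step (.ask m) fun (σ : M.Sig) => .ret σ) vk).expect I D (D.sign sk)
        (forgeryWeight D vk) [] (zeroState M.N _ _) +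
      (A.simulate (fun m => .step (.ask m) fun (σ : M.Sig) => .ret σ) vk).expect I D (D.sign sk)
        (fun _ => testedWeight I) [] (zeroState M.N _ _) := by
  rw [← Prog.expect_add, A.expect_simulate I D (signs_ask I D sk), Attack.prob]
  · refine Finset.sum_le_sum fun x _ => Finset.sum_le_sum fun y _ => ?_
    -- Bills of probability zero may have a serial number far from their eigenvector. For the others
    -- the amplitude is nonzero, so the serial number is near, as extraction requires.
    by_cases hy : ∏ i, billProb I D sk (y i) = 0
    · rw [hy, mul_zero, zero_mul, zero_mul]
    refine mul_le_mul_of_nonneg_left ?_ (mul_nonneg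
      (Finset.prod_nonneg fun i _ => billProb_nonneg I D sk _)
      (Finset.prod_nonneg fun i _ => billProb_nonneg I D sk _))
    rw [Prog.expect_bind]
    refine Prog.expect_mono I D _ (fun l z φ => ?_) _ _ _
    rw [list_eq_nil_of_isEmpty l, ← Bills.passWeight_eq]
    have hk : ∀ j, ‖I.val (y j).2.1 - I.eig (y j).1‖ < I.ε / 2 := fun j => by
      refine I.near_of_amp_ne_zero fun h0 => hy (Finset.prod_eq_zero (Finset.mem_univ j) ?_)
      rw [billProb, h0, norm_zero, zero_pow two_ne_zero, mul_zero, zero_mul]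
    refine (z.passWeight_le_extract I D vk (fun i => (x i).2) (fun i => (y i).2) _ hk
      (billQueries (fun m => [m]) x ++ billQueries (fun m => [m]) y) ?_ φ).trans (le_of_eq ?_)
    · intro m hm
      simp only [billQueries, List.mem_append, List.mem_flatten, List.mem_ofFn] at hm
      rcases hm with ⟨_, ⟨j, rfl⟩, hm⟩ | ⟨_, ⟨j, rfl⟩, hm⟩
      · exact Or.inl ⟨j, List.mem_singleton.mp hm⟩
      · exact Or.inr ⟨j, List.mem_singleton.mp hm⟩
    · unfold forgeryWeight testedWeight
      cases (z.extract (fun i => (x i).2) fun i => (y i).2).2 with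
      | none => exact (add_zero _).symm
      | some e => exact (zero_add _).symm
  · intro l c a φ
    exact (congrArg₂ (· + ·) (isQuadratic_forgeryWeight D vk l c a φ)
      (isQuadratic_testedWeight I l c a φ)).trans (mul_add _ _ _).symm

/-- The algorithm, with access to a signing oracle, that results from the simulation of an attack
and returns `out c` for the extracted data `c`. -/
def Attack.oracleAlg {Out : Type → Type}
    (out : (M.Ser × M.Sig) × Option (Fin 3 ↪ A.R ⊕ Fin s × Fin 2) → Out (A.R ⊕ Fin s × Fin 2)) :
    Alg M M.Ser M.VK 0 Out where
  R := A.R ⊕ Fin s × Fin 2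
  Q := A.Q ⊕ Empty
  finR := inferInstance
  decR := inferInstance
  finQ := inferInstance
  decQ := inferInstance
  inReg := ⟨fun p => p.1.elim0, fun p => p.1.elim0⟩
  prog vk := (A.simulate (fun m => .step (.ask m) fun (σ : M.Sig) => .ret σ) vk).bind
    fun c => .ret (out c)

theorem Attack.runsIn_oracleAlg {Out : Type → Type} {T : ℕ} (hA : A.RunsIn T)
    (out : (M.Ser × M.Sig) × Option (Fin 3 ↪ A.R ⊕ Fin s × Fin 2) → Out (A.R ⊕ Fin s × Fin 2)) :
    (A.oracleAlg out).RunsIn (1 * T + M.mintTime * (n + s)) := by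
  intro vk
  have h : ((A.oracleAlg out).prog vk).cost ≤ T + M.mintTime * (n + s) :=
    (Prog.cost_bind_le _ _ 0 fun _ => le_rfl).trans
      (A.cost_simulate_le hA (fun m => Prog.cost_step_le _ _ 0 fun _ => le_rfl) vk)
  rw [one_mul]
  exact_mod_cast h

theorem Attack.asksAtMost_oracleAlg {Out : Type → Type}
    (out : (M.Ser × M.Sig) × Option (Fin 3 ↪ A.R ⊕ Fin s × Fin 2) → Out (A.R ⊕ Fin s × Fin 2)) :
    (A.oracleAlg out).AsksAtMost (n + s) := fun vk =>
  (Prog.asks_bind_le _ _ 0 fun _ => le_rfl).trans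
    (A.asks_simulate_le (fun m => Prog.asks_step_le (.ask m) _ 0 fun _ => le_rfl) vk)

theorem Attack.exists_forgerOrSolver {T : ℕ} (hA : A.RunsIn T) :
    ∃ B : ForgerOrSolver M, B.RunsIn (1 * T + M.mintTime * (n + s)) ∧ B.AsksAtMost (n + s) ∧
      ∀ (I : Instance M) (D : SigScheme M) (vk : M.VK) (sk : M.SK) (p : ℝ),
        p ≤ A.prob I D vk sk → p ≤ B.prob I D vk sk := by
  refine ⟨A.oracleAlg (Out := fun R => (M.Ser × M.Sig) ⊕ (Fin 3 ↪ R))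
    fun c => c.2.elim (.inl c.1) .inr, A.runsIn_oracleAlg hA _, A.asksAtMost_oracleAlg _,
    fun I D vk sk p hp => hp.trans ((A.prob_le_simulate I D vk sk).trans ?_)⟩
  rw [← Prog.expect_add, ForgerOrSolver.prob, init_eq_zeroState]
  refine le_trans ?_ (Prog.expect_bind I D (D.sign sk) _ _ _ _ _).ge
  refine Prog.expect_mono I D _ (fun l c φ => ?_) _ _ _
  obtain ⟨c, o⟩ := c
  cases o with
  | none => exact (add_zero _).le
  -- No test is performed here: the output registers have at least the weight that a test would
  -- find.
  | some e => exact (zero_add _).le.trans (normSq_tripleTest_le I c.1 e φ)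

/-- Generate a pair of keys, and search for a triple by simulating the attack. -/
def Attack.search : Prog M Empty (A.R ⊕ Fin s × Fin 2) (A.Q ⊕ Empty)
    (Option (M.Ser × (Fin 3 ↪ A.R ⊕ Fin s × Fin 2))) :=
  .step .keyGen fun (a : M.VK × M.SK) =>
    (A.simulate (fun m => .step (.sign a.2 m) fun (σ : M.Sig) => .ret σ) a.1).bind fun c =>
      .ret (c.2.map fun e => (c.1.1, e))

theorem Attack.cost_search_le {T : ℕ} (hA : A.RunsIn T) :
    A.search.cost ≤ M.costGen + (T + M.mintTime * (n + s)) :=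
  Prog.cost_step_le _ _ _ fun _ => (Prog.cost_bind_le _ _ 0 fun _ => le_rfl).trans
    (A.cost_simulate_le hA (fun _ => Prog.cost_step_le _ _ 0 fun _ => le_rfl) _)

/-- Key generation contributes the weights of the average. For fixed keys, signing with the
generated key has the same effect on the tested weight as calling the oracle, because that weight
does not depend on the log. -/
theorem Attack.expect_search :
    A.search.expect I D (fun a => a.elim)
      (fun _ o φ => o.elim 0 fun c => normSq (tripleTest I c.1 c.2 φ)) [] (zeroState M.N _ _) =
    D.keyAverage fun vk sk =>
      (A.simulate (fun m => .step (.ask m) fun (σ : M.Sig) => .ret σ) vk).expect I D (D.sign sk)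
        (fun _ => testedWeight I) [] (zeroState M.N _ _) := by
  have h : ∀ (a : M.VK × M.SK) φ,
      ((A.simulate (fun m => .step (.sign a.2 m) fun (σ : M.Sig) => .ret σ) a.1).bind fun c =>
        Prog.ret (c.2.map fun e => (c.1.1, e))).expect I D (fun a : Empty => a.elim)
        (fun _ o φ => o.elim 0 fun c => normSq (tripleTest I c.1 c.2 φ)) [] φ =
      (A.simulate (fun m => .step (.sign a.2 m) fun (σ : M.Sig) => .ret σ) a.1).expect I D
        (fun a : Empty => a.elim) (fun _ => testedWeight I) [] φ := fun a φ => by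
    rw [Prog.expect_bind]
    congr 1
    funext l c φ
    obtain ⟨c, o⟩ := c
    cases o <;> rfl
  refine Finset.sum_congr rfl fun a _ => ?_
  refine (h a _).trans ?_
  refine (Prog.expect_smul I D _ (isQuadratic_testedWeight I) _ _ _ _).trans ?_
  rw [Complex.norm_real, Real.norm_eq_abs, sq_abs, Real.sq_sqrt ENNReal.toReal_nonneg]
  refine congrArg _ ?_
  exact (A.expect_simulate I D (signs_sign I D _ a.2) (isQuadratic_testedWeight I) a.1).trans
    (A.expect_simulate I D (signs_ask I D a.2) (isQuadratic_testedWeight I) a.1).symm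

theorem keyAverage_mono {f g : M.VK → M.SK → ℝ} (h : ∀ vk sk, f vk sk ≤ g vk sk) :
    D.keyAverage f ≤ D.keyAverage g :=
  Finset.sum_le_sum fun _ _ => mul_le_mul_of_nonneg_left (h _ _) ENNReal.toReal_nonneg

theorem keyAverage_add (f g : M.VK → M.SK → ℝ) :
    D.keyAverage (fun vk sk => f vk sk + g vk sk) = D.keyAverage f + D.keyAverage g := by
  simp only [SigScheme.keyAverage, mul_add, Finset.sum_add_distrib]

theorem Attack.exists_forger_and_solver {T : ℕ} {p : ℝ} (hp : 0 < p) (hp1 : p ≤ 1)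
    (hA : A.RunsIn T) :
    ∃ (B₁ : Forger M) (B₂ : Solver M Unit),
      B₁.RunsIn (6 * T + M.mintTime * (n + s)) ∧ B₁.AsksAtMost (n + s) ∧
      B₂.RunsIn (6 * ((T + M.mintTime * (n + s) + M.verifyTime + M.costGen) / p)) ∧
      ∀ (I : Instance M) (D : SigScheme M),
        p ≤ D.keyAverage (fun vk sk => A.prob I D vk sk) →
          p / 2 ≤ D.keyAverage (fun vk sk => B₁.prob I D vk sk) ∨ 1 / 2 ≤ B₂.prob I D () := by
  -- Each search may only have success weight `p / 2`, so `⌈2 / p⌉₊ ≤ 3 / p` attempts are made. Each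
  -- costs at most twice the stated sum, which gives `6`; the forger alone would need only `1`.
  refine ⟨A.oracleAlg (Out := fun _ => M.Ser × M.Sig) Prod.fst,
    Solver.iterate (fun _ => attempt A.search) ⌈2 / p⌉₊, fun vk => ?_, A.asksAtMost_oracleAlg _,
    fun x => ?_, fun I D h => ?_⟩
  · refine (A.runsIn_oracleAlg (Out := fun _ => M.Ser × M.Sig) hA Prod.fst vk).trans ?_
    gcongr
    norm_num
  · have h := Solver.cost_iterate_le (In := Unit)
      (c := M.costGen + (T + M.mintTime * (n + s)) + 3 * M.costTest)
      (P := fun _ => attempt A.search)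
      (fun _ => (cost_attempt_le _).trans (Nat.add_le_add_right (A.cost_search_le hA) _))
      ⌈2 / p⌉₊ x
    have h2 : M.costGen + (T + M.mintTime * (n + s)) + 3 * M.costTest ≤
        2 * (T + M.mintTime * (n + s) + M.verifyTime + M.costGen) := by
      rw [Model.verifyTime]; omega
    calc _ ≤ ((⌈2 / p⌉₊ *
            (2 * (T + M.mintTime * (n + s) + M.verifyTime + M.costGen)) : ℕ) : ℝ) :=
          Nat.cast_le.mpr (h.trans (Nat.mul_le_mul_left _ h2))
      _ = ⌈2 / p⌉₊ * (2 * ((T : ℝ) + M.mintTime * (n + s) + M.verifyTime + M.costGen)) := by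
          push_cast; ring
      _ ≤ ((2 + 1) / p) * (2 * ((T : ℝ) + M.mintTime * (n + s) + M.verifyTime + M.costGen)) :=
          mul_le_mul_of_nonneg_right (ceil_div_le one_le_two hp hp1) (by positivity)
      _ = _ := by ring
  · have h1 := h.trans (keyAverage_mono D fun vk sk => A.prob_le_simulate I D vk sk)
    rw [keyAverage_add, ← A.expect_search] at h1
    -- Both algorithms are already fixed. Only the alternative that holds depends on `I` and `D`,
    -- according to which of the two averaged weights is large.
    by_cases hf : p / 2 ≤ D.keyAverage fun vk sk =>
        (A.simulate (fun m => .step (.ask m) fun (σ : M.Sig) => .ret σ) vk).expect I D (D.sign sk)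
          (forgeryWeight D vk) [] (zeroState M.N _ _)
    · refine Or.inl (hf.trans (keyAverage_mono D fun vk sk => ?_))
      rw [Forger.prob, init_eq_zeroState]
      refine le_trans ?_ (Prog.expect_bind I D (D.sign sk) _ _ _ _ _).ge
      refine Prog.expect_mono I D _ (fun l c φ => ?_) _ _ _
      obtain ⟨c, o⟩ := c
      cases o with
      | none => exact le_rfl
      | some e => exact newSigWeight_nonneg D vk l c φ
    · have hp2 : p / 2 ≤ 1 := by linarith
      refine Or.inr ((half_le_one_sub_pow hp2 (m := ⌈2 / p⌉₊) ?_).trans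
        (Solver.le_prob_iterate I D (P := fun _ => attempt A.search) hp2 (fun q hq =>
          le_expect_attempt I D hq normSq_zeroState (by linarith)) _))
      rw [← div_le_iff₀' (by linarith), one_div_div]
      exact Nat.le_ceil _

end Simulation

end QMoney

end

theorem theorem3p3 :
    -- attacks by the mint
    (∃ C κ : ℝ, 0 < C ∧ 0 < κ ∧
      ∀ (M : QMoney.Model) (n T : ℕ) (p : ℝ), 0 < p → p ≤ 1 →
      ∀ A : QMoney.MintAttack M n, A.RunsIn T →
      ∃ B : QMoney.Solver M (M.VK × M.SK), B.RunsIn (C * ((T + M.verifyTime) / p)) ∧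
        ∀ (I : QMoney.Instance M) (D : QMoney.SigScheme M) (vk : M.VK) (sk : M.SK),
          p ≤ A.prob I D vk sk → κ ≤ B.prob I D (vk, sk)) ∧
    -- attacks by others
    (∃ C : ℝ, 0 < C ∧
      ∀ (M : QMoney.Model) (n s T : ℕ) (A : QMoney.Attack M n s), A.RunsIn T →
      ∃ B : QMoney.ForgerOrSolver M,
        B.RunsIn (C * T + M.mintTime * (n + s)) ∧ B.AsksAtMost (n + s) ∧
        ∀ (I : QMoney.Instance M) (D : QMoney.SigScheme M) (vk : M.VK) (sk : M.SK) (p : ℝ),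
          p ≤ A.prob I D vk sk → p ≤ B.prob I D vk sk) ∧
    -- attacks on random instances
    (∃ C : ℝ, 0 < C ∧
      ∀ (M : QMoney.Model) (n s T : ℕ) (p : ℝ), 0 < p → p ≤ 1 →
      ∀ A : QMoney.Attack M n s, A.RunsIn T →
      ∃ (B₁ : QMoney.Forger M) (B₂ : QMoney.Solver M Unit),
        B₁.RunsIn (C * T + M.mintTime * (n + s)) ∧ B₁.AsksAtMost (n + s) ∧
        B₂.RunsIn (C * ((T + M.mintTime * (n + s) + M.verifyTime + M.costGen) / p)) ∧
        ∀ (I : QMoney.Instance M) (D : QMoney.SigScheme M),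
          p ≤ D.keyAverage (fun vk sk => A.prob I D vk sk) →
            p / 2 ≤ D.keyAverage (fun vk sk => B₁.prob I D vk sk) ∨
            1 / 2 ≤ B₂.prob I D ()) := by
  refine ⟨⟨4, 1 / 2, by norm_num, by norm_num, fun M n T p hp hp1 A hA =>
      QMoney.exists_solver_of_mintAttack A T hp hp1 hA⟩,
    ⟨1, one_pos, fun M n s T A hA => A.exists_forgerOrSolver hA⟩,
    ⟨6, by norm_num, fun M n s T p hp hp1 A hA => A.exists_forger_and_solver hp hp1 hA⟩⟩
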